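/- Let $D\subseteq\mathbb C$ be open (for instance $D=\mathbb C$), let $f$ be a meromorphic function on $D$ with set of poles $\mathcal P$ (so $f$ is holomorphic on $D\setminus\mathcal P$), and let $A\in\mathbb C^{m\times m}$ be a matrix whose spectrum $\mathcal S$ satisfies $\mathcal S\cap\mathcal P=\emptyset$. Let $\Gamma$ be a positively oriented rectifiable simple closed curve (given by an absolutely continuous parametrization) such that $\Gamma$ and the region it encloses lie in $D$, and no pole of $f$ lies on $\Gamma$. Here the enclosed region is the set of points off $\Gamma$ that lie in a bounded connected component of $\mathbb C\setminus\Gamma$, and positively oriented means that $\Gamma$ has winding number $1$ about each point of it. Suppose that $\Gamma$ encloses $\mathcal S$, and that the poles of $f$ enclosed by $\Gamma$ are exactly the distinct points $z_1,\dots,z_t$, of orders $d_1,\dots,d_t$. Then \[ \frac1{2\pi i}\int_\Gamma (zI-A)^{-1}f(z)\,dz=f(A)+\sum_{j=1}^t R_j(z_jI-A), \] where \[ R_j(z)=\sum_{l=1}^{d_j}(-1)^{l+1}\,\frac{f_j^{(d_j-l)}(z_j)}{(d_j-l)!}\,z^{-l}, \qquad f_j(z)=(z-z_j)^{d_j}f(z),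 \] with $f_j$ extended to $z_j$ by its limit there. Here $f(A)$ is the matrix function defined through the Jordan canonical form: if $V^{-1}AV=\operatorname{diag}(J_1,\dots,J_p)$ with Jordan blocks $J_k$ of size $m_k$ and eigenvalue $\lambda_k$, then $f(A)=V\operatorname{diag}(f(J_1),\dots,f(J_p))V^{-1}$, where $f(J_k)$ is the upper triangular $m_k\times m_k$ matrix with entries $f^{(b-a)}(\lambda_k)/(b-a)!$ in position $(a,b)$ for $a\le b$. In particular, if $d_j=1$ for all $j$, then \[ \frac1{2\pi i}\int_\Gamma (zI-A)^{-1}f(z)\,dz=f(A)+\sum_{j=1}^t f_j(z_j)\,(z_jI-A)^{-1}. \] -/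

import Mathlib

open Set Filter Topology

noncomputable section

/-! ### Matrix functions through the Jordan canonical form -/

/-- The `n × n` Jordan block with eigenvalue `lam`. -/
def jordanBlock (lam : ℂ) (n : ℕ) : Matrix (Fin n) (Fin n) ℂ :=
  Matrix.of fun i j =>
    if i = j then lam else if (j : ℕ) = (i : ℕ) + 1 then 1 else 0

/-- `f` of the `n × n` Jordan block with eigenvalue `lam`: the upper triangular Toeplitz matrix
with entries `f^(j-i)(lam) / (j-i)!` for `i ≤ j`. -/
def jordanBlockFun (f : ℂ → ℂ) (lam : ℂ) (n : ℕ) : Matrix (Fin n) (Fin n) ℂ :=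
  Matrix.of fun i j =>
    if i ≤ j then
      iteratedDeriv ((j : ℕ) - (i : ℕ)) f lam / (Nat.factorial ((j : ℕ) - (i : ℕ)) : ℂ)
    else 0

/-- A Jordan canonical form `V⁻¹ A V = diag(J₁, …, J_p)` of `A`. The equivalence `index` places
the rows and columns of the blocks among the `m` rows and columns of the matrix. -/
structure JordanForm {m : ℕ} (A : Matrix (Fin m) (Fin m) ℂ) where
  p : ℕ
  size : Fin p → ℕ
  size_pos : ∀ k, 0 < size k
  eigenvalue : Fin p → ℂ
  index : (Σ k : Fin p, Fin (size k)) ≃ Fin m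
  V : Matrix (Fin m) (Fin m) ℂ
  isUnit_V : IsUnit V
  conj_eq : V⁻¹ * A * V =
    Matrix.reindex index index
      (Matrix.blockDiagonal' fun k => jordanBlock (eigenvalue k) (size k))

/-- `V · diag(f(J₁), …, f(J_p)) · V⁻¹` for a Jordan canonical form of `A`. -/
def JordanForm.apply {m : ℕ} {A : Matrix (Fin m) (Fin m) ℂ} (J : JordanForm A) (f : ℂ → ℂ) :
    Matrix (Fin m) (Fin m) ℂ :=
  J.V * Matrix.reindex J.index J.index
    (Matrix.blockDiagonal' fun k => jordanBlockFun f (J.eigenvalue k) (J.size k)) * J.V⁻¹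

open Classical in
/-- The matrix function `f(A)`, computed from a Jordan canonical form of `A`. Every complex square
matrix has one, so the second branch never occurs; when `f` is holomorphic near the spectrum of
`A`, the value does not depend on the form that is chosen. -/
def matrixFunction (f : ℂ → ℂ) {m : ℕ} (A : Matrix (Fin m) (Fin m) ℂ) :
    Matrix (Fin m) (Fin m) ℂ :=
  if h : Nonempty (JordanForm A) then h.some.apply f else 0

/-- The resolvent `(z I - A)⁻¹`. -/
def matrixResolvent {m : ℕ} (A : Matrix (Fin m) (Fin m) ℂ) (z : ℂ) :
    Matrix (Fin m) (Fin m) ℂ :=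
  (z • (1 : Matrix (Fin m) (Fin m) ℂ) - A)⁻¹

/-! ### Contours -/

/-- A closed path that does not meet itself except at its end points. -/
def IsSimpleClosed {x : ℂ} (γ : Path x x) : Prop :=
  ∀ s t : unitInterval, γ s = γ t → s = t ∨ (s = 0 ∧ t = 1) ∨ (s = 1 ∧ t = 0)

/-- The region enclosed by a closed path: the points off the path whose component in the
complement of the path is bounded. -/
def enclosedRegion {x : ℂ} (γ : Path x x) : Set ℂ :=
  {w | w ∉ range γ ∧ Bornology.IsBounded (connectedComponentIn (range γ)ᶜ w)}

/-- The complex contour integral `∫_γ g(z) dz`. -/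
def contourIntegral {x : ℂ} (γ : Path x x) (g : ℂ → ℂ) : ℂ :=
  curveIntegral (fun z : ℂ => g z • (1 : ℂ →L[ℂ] ℂ)) γ

/-- The contour integral of a matrix-valued function, taken entrywise. -/
def matrixContourIntegral {m : ℕ} {x : ℂ} (γ : Path x x)
    (G : ℂ → Matrix (Fin m) (Fin m) ℂ) : Matrix (Fin m) (Fin m) ℂ :=
  Matrix.of fun i j => contourIntegral γ fun z => G z i j

/-- The winding number `(1 / 2πi) ∫_γ dz / (z - w)`. -/
def windingNumber {x : ℂ} (γ : Path x x) (w : ℂ) : ℂ :=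
  (2 * Real.pi * Complex.I)⁻¹ * contourIntegral γ fun z => (z - w)⁻¹

/-- A simple closed rectifiable curve, in an absolutely continuous parametrization, that is
traversed once counterclockwise: it has winding number `1` about every point it encloses. -/
structure IsPositiveJordanContour {x : ℂ} (γ : Path x x) : Prop where
  simple : IsSimpleClosed γ
  absCont : AbsolutelyContinuousOnInterval γ.extend 0 1
  positive : ∀ w ∈ enclosedRegion γ, windingNumber γ w = 1

/-! ### Meromorphic functions and the correction term -/

/-- The poles of `f` in `D`. -/
def polesIn (f : ℂ → ℂ) (D : Set ℂ) : Set ℂ :=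
  {w | w ∈ D ∧ meromorphicOrderAt f w < 0}

/-- `f` is a meromorphic function on `D`: it is meromorphic at every point of `D`, and holomorphic
away from its poles. -/
structure IsMeromorphicFunctionOn (f : ℂ → ℂ) (D : Set ℂ) : Prop where
  meromorphic : MeromorphicOn f D
  holomorphic : ∀ w ∈ D \ polesIn f D, AnalyticAt ℂ f w

/-- The function `z ↦ (z - w) ^ d * f z`, extended to `w` by its limit there. -/
def poleRemoved (f : ℂ → ℂ) (w : ℂ) (d : ℕ) : ℂ → ℂ :=
  Function.update (fun z => (z - w) ^ d * f z) w
    (limUnder (𝓝[≠] w) fun z => (z - w) ^ d * f z)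

/-- The rational function
`R(z) = ∑_{l=1}^d (-1)^(l+1) g^(d-l)(w) / (d-l)! * z^(-l)`, where `g z = (z - w)^d f z`,
evaluated at a matrix `M`. -/
def correctionTerm (f : ℂ → ℂ) (w : ℂ) (d : ℕ) {m : ℕ} (M : Matrix (Fin m) (Fin m) ℂ) :
    Matrix (Fin m) (Fin m) ℂ :=
  ∑ l ∈ Finset.Icc 1 d,
    ((-1 : ℂ) ^ (l + 1) * (iteratedDeriv (d - l) (poleRemoved f w d) w /
      (Nat.factorial (d - l) : ℂ))) • (M⁻¹) ^ l

end

/-! Subtract from `f` its principal parts at the enclosed poles. The difference `h` extends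
holomorphically to a neighbourhood of the curve and the region it encloses
(`analyticAt_regularPartExt_pole`). In a Jordan basis the resolvent is block diagonal, with entries
`(w - lam)⁻¹ ^ (k + 1)`, so everything reduces to the scalar integrals of
`contourIntegral_meromorphic_mul_inv_pow`. There `h` contributes its Taylor coefficient at `lam` by
Cauchy's formula for derivatives, while each principal part contributes zero: partial fractions
reduce products of negative powers at two enclosed points to powers with a primitive and to a
difference of two equal winding numbers. Hence the integral is `2πi · h(A)`.

Since `f ↦ f(A)` is linear and multiplicative on functions analytic at the eigenvalues, `h(A)` is
`f(A)` minus the principal parts evaluated at `A`, and these are the `-R_j(z_j I - A)`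
(`JordanForm.apply_principalPart`).

Two supports carry the argument. Cauchy's theorem is proved for absolutely continuous curves by
Dixon's argument, which needs only that winding numbers vanish on unbounded components, not the
Jordan curve theorem. Jordan forms exist by the structure theorem for torsion modules over `ℂ[X]`.
-/

open MeasureTheory

/-! ### Absolutely continuous complex-valued functions -/

lemma AbsolutelyContinuousOnInterval.lipschitzOnWith_comp {X Y : Type*} [PseudoMetricSpace X]
    [PseudoMetricSpace Y] {f : ℝ → X} {g : X → Y} {s : Set X} {K : NNReal} {a b : ℝ}
    (hg : LipschitzOnWith K g s) (hf : AbsolutelyContinuousOnInterval f a b)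
    (hs : MapsTo f (uIcc a b) s) : AbsolutelyContinuousOnInterval (g ∘ f) a b := by
  have hf' := Tendsto.const_mul (K : ℝ) hf
  rw [mul_zero] at hf'
  refine squeeze_zero' (Eventually.of_forall fun E => Finset.sum_nonneg fun i _ => dist_nonneg) ?_
    hf'
  rw [eventually_inf_principal]
  refine Eventually.of_forall fun E hE => ?_
  rw [Finset.mul_sum]
  exact Finset.sum_le_sum fun i hi =>
    hg.dist_le_mul _ (hs (hE.1 i hi).1) _ (hs (hE.1 i hi).2)

lemma AbsolutelyContinuousOnInterval.re {f : ℝ → ℂ} {a b : ℝ}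
    (hf : AbsolutelyContinuousOnInterval f a b) :
    AbsolutelyContinuousOnInterval (fun t => (f t).re) a b :=
  hf.lipschitzOnWith_comp (K := 1) (s := univ)
    (LipschitzOnWith.of_dist_le_mul fun x _ y _ => by
      simpa [Complex.dist_eq, Real.dist_eq] using Complex.abs_re_le_norm (x - y))
    (mapsTo_univ _ _)

lemma AbsolutelyContinuousOnInterval.im {f : ℝ → ℂ} {a b : ℝ}
    (hf : AbsolutelyContinuousOnInterval f a b) :
    AbsolutelyContinuousOnInterval (fun t => (f t).im) a b :=
  hf.lipschitzOnWith_comp (K := 1) (s := univ)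
    (LipschitzOnWith.of_dist_le_mul fun x _ y _ => by
      simpa [Complex.dist_eq, Real.dist_eq] using Complex.abs_im_le_norm (x - y))
    (mapsTo_univ _ _)

/-- The real theory applies to the real and imaginary parts; this formula for the derivative carries
integrability and the fundamental theorem of calculus over to complex values. -/
lemma AbsolutelyContinuousOnInterval.ae_hasDerivAt_complex {f : ℝ → ℂ} {a b : ℝ}
    (hf : AbsolutelyContinuousOnInterval f a b) :
    ∀ᵐ t : ℝ, t ∈ uIcc a b → HasDerivAt f
      (((deriv (fun t => (f t).re) t : ℝ) : ℂ) + ((deriv (fun t => (f t).im) t : ℝ) : ℂ) * Complex.I) t := by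
  filter_upwards [hf.re.ae_differentiableAt, hf.im.ae_differentiableAt] with t h1 h2 ht
  have := (h1 ht).hasDerivAt.ofReal_comp.add ((h2 ht).hasDerivAt.ofReal_comp.mul_const Complex.I)
  refine this.congr_of_eventuallyEq (Eventually.of_forall fun s => ?_)
  simp [Complex.re_add_im]

lemma AbsolutelyContinuousOnInterval.ae_deriv_complex {f : ℝ → ℂ} {a b : ℝ}
    (hf : AbsolutelyContinuousOnInterval f a b) :
    ∀ᵐ t : ℝ, t ∈ uIoc a b →
      ((deriv (fun t => (f t).re) t : ℝ) : ℂ) + ((deriv (fun t => (f t).im) t : ℝ) : ℂ) * Complex.I =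
        deriv f t := by
  filter_upwards [hf.ae_hasDerivAt_complex] with t h ht
  exact (h (uIoc_subset_uIcc ht)).deriv.symm

lemma AbsolutelyContinuousOnInterval.intervalIntegrable_deriv_complex {f : ℝ → ℂ} {a b : ℝ}
    (hf : AbsolutelyContinuousOnInterval f a b) : IntervalIntegrable (deriv f) volume a b := by
  have h1 : IntervalIntegrable (fun t => ((deriv (fun t => (f t).re) t : ℝ) : ℂ)) volume a b :=
    ⟨hf.re.intervalIntegrable_deriv.1.ofReal, hf.re.intervalIntegrable_deriv.2.ofReal⟩
  have h2 : IntervalIntegrable (fun t => ((deriv (fun t => (f t).im) t : ℝ) : ℂ)) volume a b :=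
    ⟨hf.im.intervalIntegrable_deriv.1.ofReal, hf.im.intervalIntegrable_deriv.2.ofReal⟩
  refine (h1.add (h2.mul_const Complex.I)).congr_ae ?_
  rw [EventuallyEq, ae_restrict_iff' measurableSet_uIoc]
  exact hf.ae_deriv_complex

lemma AbsolutelyContinuousOnInterval.integral_deriv_eq_sub_complex {f : ℝ → ℂ} {a b : ℝ}
    (hf : AbsolutelyContinuousOnInterval f a b) : ∫ t in a..b, deriv f t = f b - f a := by
  have h1 : IntervalIntegrable (fun t => ((deriv (fun t => (f t).re) t : ℝ) : ℂ)) volume a b :=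
    ⟨hf.re.intervalIntegrable_deriv.1.ofReal, hf.re.intervalIntegrable_deriv.2.ofReal⟩
  have h2 : IntervalIntegrable (fun t => ((deriv (fun t => (f t).im) t : ℝ) : ℂ)) volume a b :=
    ⟨hf.im.intervalIntegrable_deriv.1.ofReal, hf.im.intervalIntegrable_deriv.2.ofReal⟩
  rw [← intervalIntegral.integral_congr_ae hf.ae_deriv_complex,
    intervalIntegral.integral_add h1 (h2.mul_const Complex.I), intervalIntegral.integral_mul_const,
    intervalIntegral.integral_ofReal, intervalIntegral.integral_ofReal,
    hf.re.integral_deriv_eq_sub, hf.im.integral_deriv_eq_sub]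
  apply Complex.ext <;> simp

/-! ### Contour integrals along absolutely continuous closed paths -/

lemma Path.range_extend_eq {x : ℂ} (γ : Path x x) : range γ.extend = range γ :=
  Path.extend_range γ

lemma contourIntegral_eq_intervalIntegral {x : ℂ} (γ : Path x x) (g : ℂ → ℂ) :
    contourIntegral γ g = ∫ t in (0 : ℝ)..1, g (γ.extend t) * deriv γ.extend t := by
  rw [contourIntegral, curveIntegral_eq_intervalIntegral_deriv]
  simp

lemma Path.extend_mem_range {x : ℂ} (γ : Path x x) (t : ℝ) : γ.extend t ∈ range γ :=
  γ.range_extend_eq ▸ mem_range_self t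

lemma isCompact_range_path {x : ℂ} (γ : Path x x) : IsCompact (range γ) :=
  isCompact_range γ.continuous

section contour

variable {x : ℂ} {γ : Path x x}

lemma continuous_comp_extend {g : ℂ → ℂ} (hg : ContinuousOn g (range γ)) :
    Continuous fun t => g (γ.extend t) :=
  hg.comp_continuous γ.continuous_extend γ.extend_mem_range

lemma intervalIntegrable_contour (hγ : AbsolutelyContinuousOnInterval γ.extend 0 1) {g : ℂ → ℂ}
    (hg : ContinuousOn g (range γ)) :
    IntervalIntegrable (fun t => g (γ.extend t) * deriv γ.extend t) volume 0 1 :=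
  hγ.intervalIntegrable_deriv_complex.continuousOn_mul (continuous_comp_extend hg).continuousOn

lemma contourIntegral_congr {g h : ℂ → ℂ} (H : EqOn g h (range γ)) :
    contourIntegral γ g = contourIntegral γ h := by
  simp only [contourIntegral_eq_intervalIntegral]
  congr 1; ext t; rw [H (γ.extend_mem_range t)]

lemma contourIntegral_add (hγ : AbsolutelyContinuousOnInterval γ.extend 0 1) {g h : ℂ → ℂ}
    (hg : ContinuousOn g (range γ)) (hh : ContinuousOn h (range γ)) :
    contourIntegral γ (fun z => g z + h z) = contourIntegral γ g + contourIntegral γ h := by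
  simp only [contourIntegral_eq_intervalIntegral, add_mul]
  exact intervalIntegral.integral_add (intervalIntegrable_contour hγ hg)
    (intervalIntegrable_contour hγ hh)

lemma contourIntegral_sub (hγ : AbsolutelyContinuousOnInterval γ.extend 0 1) {g h : ℂ → ℂ}
    (hg : ContinuousOn g (range γ)) (hh : ContinuousOn h (range γ)) :
    contourIntegral γ (fun z => g z - h z) = contourIntegral γ g - contourIntegral γ h := by
  simp only [contourIntegral_eq_intervalIntegral, sub_mul]
  exact intervalIntegral.integral_sub (intervalIntegrable_contour hγ hg)
    (intervalIntegrable_contour hγ hh)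

lemma contourIntegral_const_mul (c : ℂ) (g : ℂ → ℂ) :
    contourIntegral γ (fun z => c * g z) = c * contourIntegral γ g := by
  simp only [contourIntegral_eq_intervalIntegral, mul_assoc]
  exact intervalIntegral.integral_const_mul _ _

lemma contourIntegral_zero : contourIntegral γ (fun _ => 0) = 0 := by
  simp [contourIntegral_eq_intervalIntegral]

lemma contourIntegral_finset_sum (hγ : AbsolutelyContinuousOnInterval γ.extend 0 1) {ι : Type*}
    (s : Finset ι) {g : ι → ℂ → ℂ} (hg : ∀ i ∈ s, ContinuousOn (g i) (range γ)) :
    contourIntegral γ (fun z => ∑ i ∈ s, g i z) = ∑ i ∈ s, contourIntegral γ (g i) := by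
  simp only [contourIntegral_eq_intervalIntegral, Finset.sum_mul]
  exact intervalIntegral.integral_finsetSum fun i hi => intervalIntegrable_contour hγ (hg i hi)

/-- The Lipschitz bound makes `F ∘ γ` absolutely continuous, so its derivative integrates to the
difference of its end values, which is zero on a closed path. -/
lemma contourIntegral_of_hasDerivAt (hγ : AbsolutelyContinuousOnInterval γ.extend 0 1)
    {F g : ℂ → ℂ} {K : NNReal} (hF : LipschitzOnWith K F (range γ))
    (hFg : ∀ z ∈ range γ, HasDerivAt F (g z) z) : contourIntegral γ g = 0 := by
  have hac : AbsolutelyContinuousOnInterval (F ∘ γ.extend) 0 1 :=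
    hγ.lipschitzOnWith_comp hF fun t _ => γ.extend_mem_range t
  have h := hac.integral_deriv_eq_sub_complex
  rw [contourIntegral_eq_intervalIntegral]
  have h2 : ∫ t in (0 : ℝ)..1, deriv (F ∘ γ.extend) t =
      ∫ t in (0 : ℝ)..1, g (γ.extend t) * deriv γ.extend t := by
    apply intervalIntegral.integral_congr_ae
    filter_upwards [hγ.ae_hasDerivAt_complex] with t ht ht'
    have h3 := (ht (uIoc_subset_uIcc ht')).differentiableAt.hasDerivAt
    exact ((hFg _ (γ.extend_mem_range t)).comp_of_eq t h3 rfl).deriv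
  rw [← h2, h]
  simp

lemma exists_dist_lower_bound {a : ℂ} (ha : a ∉ range γ) :
    ∃ δ > 0, ∀ z ∈ range γ, δ ≤ ‖z - a‖ := by
  obtain ⟨δ, hδ, h⟩ := Metric.isOpen_iff.1 (isCompact_range_path γ).isClosed.isOpen_compl a ha
  refine ⟨δ, hδ, fun z hz => ?_⟩
  by_contra! hlt
  exact h (by simpa [dist_eq_norm] using hlt) hz

lemma lipschitzOnWith_inv_sub {a : ℂ} (ha : a ∉ range γ) :
    ∃ K : NNReal, LipschitzOnWith K (fun z => (z - a)⁻¹) (range γ) := by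
  obtain ⟨δ, hδ, h⟩ := exists_dist_lower_bound ha
  refine ⟨⟨δ⁻¹ * δ⁻¹, by positivity⟩, LipschitzOnWith.of_dist_le_mul fun z hz w hw => ?_⟩
  have hz0 : 0 < ‖z - a‖ := hδ.trans_le (h z hz)
  have hw0 : 0 < ‖w - a‖ := hδ.trans_le (h w hw)
  have : (z - a)⁻¹ - (w - a)⁻¹ = (z - a)⁻¹ * (w - a)⁻¹ * (w - z) := by
    have := norm_pos_iff.1 hz0; have := norm_pos_iff.1 hw0
    field_simp
    ring
  rw [dist_eq_norm, this, norm_mul, norm_mul, dist_comm, dist_eq_norm, norm_inv, norm_inv]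
  refine mul_le_mul_of_nonneg_right ?_ (norm_nonneg _)
  exact mul_le_mul (inv_anti₀ hδ (h z hz)) (inv_anti₀ hδ (h w hw)) (by positivity) (by positivity)

lemma sub_ne_zero_of_notMem_range {a z : ℂ} (ha : a ∉ range γ) (hz : z ∈ range γ) : z - a ≠ 0 :=
  sub_ne_zero.2 fun h => ha (h ▸ hz)

lemma continuousOn_inv_sub {a : ℂ} (ha : a ∉ range γ) :
    ContinuousOn (fun z => (z - a)⁻¹) (range γ) :=
  (continuousOn_id.sub continuousOn_const).inv₀ fun _ hz => sub_ne_zero_of_notMem_range ha hz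

lemma exists_lipschitzOnWith_pow {f : ℂ → ℂ} (n : ℕ) {s : Set ℂ} (hs : IsCompact s)
    (hf : ∃ K : NNReal, LipschitzOnWith K f s) :
    ∃ K : NNReal, LipschitzOnWith K (fun z => f z ^ n) s := by
  obtain ⟨K, hK⟩ := hf
  obtain ⟨C, hC⟩ := hs.exists_bound_of_continuousOn hK.continuousOn
  -- The ball supplies the convexity that the image of `s` may lack.
  have hp : ∃ L : NNReal, LipschitzOnWith L (fun z : ℂ => z ^ n) (Metric.closedBall 0 C) :=
    (contDiff_id.pow n).contDiffOn.exists_lipschitzOnWith (n := 1) (by decide)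
      (convex_closedBall _ _) (isCompact_closedBall _ _)
  obtain ⟨L, hL⟩ := hp
  exact ⟨L * K, hL.comp hK fun z hz => by simpa using hC z hz⟩

/-- For `n ≥ 2` the integrand has, up to a constant, the primitive `(z - a)⁻¹ ^ (n - 1)`. -/
lemma contourIntegral_inv_pow (hγ : AbsolutelyContinuousOnInterval γ.extend 0 1) {a : ℂ}
    (ha : a ∉ range γ) {n : ℕ} (hn : 2 ≤ n) :
    contourIntegral γ (fun z => ((z - a)⁻¹) ^ n) = 0 := by
  obtain ⟨k, rfl⟩ : ∃ k, n = k + 2 := ⟨n - 2, by omega⟩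
  obtain ⟨K, hK⟩ := exists_lipschitzOnWith_pow (k + 1) (isCompact_range_path γ)
    (lipschitzOnWith_inv_sub ha)
  have h := contourIntegral_of_hasDerivAt hγ (g := fun z => (-(k + 1 : ℂ)) * ((z - a)⁻¹) ^ (k + 2))
    hK fun z hz => by
      have hz := sub_ne_zero_of_notMem_range ha hz
      have := (((hasDerivAt_id z).sub_const a).inv hz).pow (k + 1)
      refine this.congr_deriv ?_
      simp only [id, Pi.inv_apply, Nat.cast_add, Nat.cast_one, Nat.add_sub_cancel,
        div_eq_mul_inv, ← inv_pow]
      ring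
  rw [contourIntegral_const_mul] at h
  refine (mul_eq_zero.1 h).resolve_left (neg_ne_zero.2 ?_)
  exact_mod_cast Nat.succ_ne_zero k

/-- Differentiation under the integral sign, dominated by `M ‖γ'‖`. -/
lemma hasDerivAt_contourIntegral (hγ : AbsolutelyContinuousOnInterval γ.extend 0 1)
    {φ φ' : ℂ → ℂ → ℂ} {a : ℂ} {s : Set ℂ} (hs : s ∈ 𝓝 a) {M : ℝ}
    (hc : ∀ z ∈ s, ContinuousOn (φ z) (range γ))
    (hd : ∀ z ∈ s, ∀ w ∈ range γ, HasDerivAt (fun z => φ z w) (φ' z w) z)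
    (hm : AEStronglyMeasurable (fun t => φ' a (γ.extend t)) (volume.restrict (uIoc 0 1)))
    (hM : ∀ z ∈ s, ∀ w ∈ range γ, ‖φ' z w‖ ≤ M) :
    HasDerivAt (fun z => contourIntegral γ (φ z)) (contourIntegral γ (φ' a)) a := by
  simp only [contourIntegral_eq_intervalIntegral]
  have hi := hγ.intervalIntegrable_deriv_complex
  refine (intervalIntegral.hasDerivAt_integral_of_dominated_loc_of_deriv_le (μ := volume)
    (F := fun z t => φ z (γ.extend t) * deriv γ.extend t)
    (F' := fun z t => φ' z (γ.extend t) * deriv γ.extend t)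
    (bound := fun t => M * ‖deriv γ.extend t‖) hs ?_ ?_ ?_ ?_ ?_ ?_).2
  · filter_upwards [hs] with z hz
    exact (intervalIntegrable_contour hγ (hc z hz)).aestronglyMeasurable_restrict_uIoc
  · exact intervalIntegrable_contour hγ (hc a (mem_of_mem_nhds hs))
  · exact hm.mul hi.aestronglyMeasurable_restrict_uIoc
  · refine Eventually.of_forall fun t _ z hz => ?_
    rw [norm_mul]
    exact mul_le_mul_of_nonneg_right (hM z hz _ (γ.extend_mem_range t)) (norm_nonneg _)
  · exact hi.norm.const_mul M
  · exact Eventually.of_forall fun t _ z hz =>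
      (hd z hz _ (γ.extend_mem_range t)).mul_const _

lemma norm_contourIntegral_le (hγ : AbsolutelyContinuousOnInterval γ.extend 0 1)
    {g : ℂ → ℂ} {M : ℝ} (hM : ∀ w ∈ range γ, ‖g w‖ ≤ M) :
    ‖contourIntegral γ g‖ ≤ M * ∫ t in (0 : ℝ)..1, ‖deriv γ.extend t‖ := by
  rw [contourIntegral_eq_intervalIntegral, ← intervalIntegral.integral_const_mul]
  refine intervalIntegral.norm_integral_le_of_norm_le zero_le_one (Eventually.of_forall
    fun t _ => ?_) (hγ.intervalIntegrable_deriv_complex.norm.const_mul M)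
  rw [norm_mul]
  exact mul_le_mul_of_nonneg_right (hM _ (γ.extend_mem_range t)) (norm_nonneg _)

end contour

/-! ### Cauchy's theorem by Dixon's argument -/

section cauchy

variable {x : ℂ} {γ : Path x x}

lemma hasDerivAt_cauchyIntegral (hγ : AbsolutelyContinuousOnInterval γ.extend 0 1) {g : ℂ → ℂ}
    (hg : ContinuousOn g (range γ)) {a : ℂ} (ha : a ∉ range γ) :
    HasDerivAt (fun z => contourIntegral γ fun w => g w * (w - z)⁻¹)
      (contourIntegral γ fun w => g w * ((w - a)⁻¹) ^ 2) a := by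
  obtain ⟨δ, hδ, hδa⟩ := exists_dist_lower_bound ha
  obtain ⟨M, hM⟩ := (isCompact_range_path γ).exists_bound_of_continuousOn hg
  have hM0 : 0 ≤ M := (norm_nonneg _).trans (hM _ (γ.extend_mem_range 0))
  have hlow : ∀ z ∈ Metric.ball a (δ / 2), ∀ w ∈ range γ, δ / 2 ≤ ‖w - z‖ := by
    intro z hz w hw
    have h1 := hδa w hw
    have h2 : ‖z - a‖ < δ / 2 := by simpa [dist_eq_norm] using hz
    have h3 : ‖w - a‖ ≤ ‖w - z‖ + ‖z - a‖ := by simpa using norm_add_le (w - z) (z - a)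
    linarith
  have hne : ∀ z ∈ Metric.ball a (δ / 2), ∀ w ∈ range γ, w - z ≠ 0 := fun z hz w hw =>
    norm_pos_iff.1 ((half_pos hδ).trans_le (hlow z hz w hw))
  have hnot : ∀ z ∈ Metric.ball a (δ / 2), z ∉ range γ := fun z hz hzr =>
    hne z hz z hzr (sub_self z)
  refine hasDerivAt_contourIntegral (φ := fun z w => g w * (w - z)⁻¹)
    (φ' := fun z w => g w * ((w - z)⁻¹) ^ 2) (M := M * ((δ / 2)⁻¹) ^ 2) hγ
    (Metric.ball_mem_nhds a (half_pos hδ)) ?_ ?_ ?_ ?_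
  · exact fun z hz => hg.mul (continuousOn_inv_sub (hnot z hz))
  · intro z hz w hw
    have := (((hasDerivAt_id z).const_sub w).inv (hne z hz w hw)).const_mul (g w)
    refine this.congr_deriv ?_
    simp
  · exact (continuous_comp_extend
      (hg.mul ((continuousOn_inv_sub ha).pow 2))).aestronglyMeasurable
  · intro z hz w hw
    rw [norm_mul, norm_pow, norm_inv]
    have := inv_anti₀ (half_pos hδ) (hlow z hz w hw)
    have := hM w hw
    gcongr

lemma exists_norm_bound_range (γ : Path x x) : ∃ R, 0 < R ∧ ∀ w ∈ range γ, ‖w‖ ≤ R := by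
  obtain ⟨R, hR⟩ := (isCompact_range_path γ).exists_bound_of_continuousOn continuousOn_id
  exact ⟨max R 1, by positivity, fun w hw => (hR w hw).trans (le_max_left _ _)⟩

lemma tendsto_cauchyIntegral (hγ : AbsolutelyContinuousOnInterval γ.extend 0 1) {g : ℂ → ℂ}
    (hg : ContinuousOn g (range γ)) :
    Tendsto (fun z => contourIntegral γ fun w => g w * (w - z)⁻¹) (cocompact ℂ) (𝓝 0) := by
  obtain ⟨M, hM⟩ := (isCompact_range_path γ).exists_bound_of_continuousOn hg
  have hM0 : 0 ≤ M := (norm_nonneg _).trans (hM _ (γ.extend_mem_range 0))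
  obtain ⟨R, -, hR⟩ := exists_norm_bound_range γ
  set L := ∫ t in (0 : ℝ)..1, ‖deriv γ.extend t‖
  have hlim : Tendsto (fun z : ℂ => M * (‖z‖ - R)⁻¹ * L) (cocompact ℂ) (𝓝 0) := by
    have h1 : Tendsto (fun z : ℂ => ‖z‖ - R) (cocompact ℂ) atTop :=
      tendsto_atTop_add_const_right _ _ (tendsto_norm_cocompact_atTop (E := ℂ))
    simpa using (h1.inv_tendsto_atTop.const_mul M).mul_const L
  refine squeeze_zero_norm' ?_ hlim
  filter_upwards [(tendsto_norm_cocompact_atTop (E := ℂ)).eventually_gt_atTop R] with z hz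
  refine norm_contourIntegral_le hγ fun w hw => ?_
  rw [norm_mul, norm_inv]
  have h1 : ‖z‖ - R ≤ ‖w - z‖ := by
    have := norm_sub_norm_le z w
    rw [norm_sub_rev] at this
    linarith [hR w hw]
  have := inv_anti₀ (sub_pos.2 hz) h1
  have := hM w hw
  gcongr

/-- The points off a closed path whose component in the complement of the path is unbounded. -/
def exteriorRegion (γ : Path x x) : Set ℂ :=
  {w | w ∉ range γ ∧ ¬ Bornology.IsBounded (connectedComponentIn (range γ)ᶜ w)}

lemma isOpen_exteriorRegion (γ : Path x x) : IsOpen (exteriorRegion γ) := by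
  rw [isOpen_iff_mem_nhds]
  intro a ha
  have ho := (isCompact_range_path γ).isClosed.isOpen_compl
  filter_upwards [ho.connectedComponentIn.mem_nhds (mem_connectedComponentIn (show
    a ∈ (range γ)ᶜ from ha.1))] with z hz
  exact ⟨connectedComponentIn_subset _ _ hz, by rw [← connectedComponentIn_eq hz]; exact ha.2⟩

/-- The ray of multiples `s * z`, `s ≥ 1`, is connected, unbounded and misses the curve. -/
lemma mem_exteriorRegion_of_lt_norm {R : ℝ} (hR0 : 0 < R) (hR : ∀ w ∈ range γ, ‖w‖ ≤ R) {z : ℂ}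
    (hz : R < ‖z‖) : z ∈ exteriorRegion γ := by
  have hS : (fun s : ℝ => (s : ℂ) * z) '' Ici 1 ⊆ (range γ)ᶜ := by
    rintro _ ⟨s, hs, rfl⟩ hmem
    have h1 := hR _ hmem
    have hs : (1 : ℝ) ≤ s := hs
    simp only [norm_mul, Complex.norm_real, Real.norm_eq_abs, abs_of_pos (zero_lt_one.trans_le hs)]
      at h1
    nlinarith [norm_nonneg z]
  have hpre : IsPreconnected ((fun s : ℝ => (s : ℂ) * z) '' Ici 1) :=
    isPreconnected_Ici.image _ (by fun_prop)
  have hzS : z ∈ (fun s : ℝ => (s : ℂ) * z) '' Ici 1 := ⟨1, self_mem_Ici, by simp⟩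
  refine ⟨hS hzS, fun hb => ?_⟩
  have hb' := hb.subset (hpre.subset_connectedComponentIn hzS hS)
  obtain ⟨C, hC⟩ := isBounded_iff_forall_norm_le.1 hb'
  have hz0 : 0 < ‖z‖ := hR0.trans hz
  have h1 := hC _ ⟨max 1 (C / ‖z‖ + 1), le_max_left (1 : ℝ) _, rfl⟩
  simp only [norm_mul, Complex.norm_real, Real.norm_eq_abs,
    abs_of_pos (zero_lt_one.trans_le (le_max_left (1 : ℝ) (C / ‖z‖ + 1)))] at h1
  have h2 := mul_le_mul_of_nonneg_right (le_max_right (1 : ℝ) (C / ‖z‖ + 1)) hz0.le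
  rw [add_mul, div_mul_cancel₀ _ hz0.ne'] at h2
  linarith

/-- The derivative in `a` is the integral of `(w - a)⁻¹ ^ 2`, which vanishes, so the integral is
constant on the component; it tends to `0` at infinity, and the component is unbounded. -/
lemma contourIntegral_inv_of_mem_exteriorRegion
    (hγ : AbsolutelyContinuousOnInterval γ.extend 0 1) {a : ℂ} (ha : a ∈ exteriorRegion γ) :
    contourIntegral γ (fun w => (w - a)⁻¹) = 0 := by
  set n : ℂ → ℂ := fun z => contourIntegral γ fun w => (1 : ℂ → ℂ) w * (w - z)⁻¹ with hn
  have hcont : ContinuousOn (1 : ℂ → ℂ) (range γ) := continuousOn_const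
  set C := connectedComponentIn (range γ)ᶜ a
  have haC : a ∈ C := mem_connectedComponentIn (show a ∈ (range γ)ᶜ from ha.1)
  have hd : ∀ z ∈ C, HasDerivAt n 0 z := fun z hz => by
    have hz' : z ∉ range γ := connectedComponentIn_subset _ _ hz
    have := hasDerivAt_cauchyIntegral hγ hcont hz'
    simpa only [hn, Pi.one_apply, one_mul, contourIntegral_inv_pow hγ hz' le_rfl] using this
  have hconst : ∀ z ∈ C, n z = n a := fun z hz =>
    (isCompact_range_path γ).isClosed.isOpen_compl.connectedComponentIn.is_const_of_deriv_eq_zero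
      isPreconnected_connectedComponentIn
      (fun z hz => (hd z hz).differentiableAt.differentiableWithinAt)
      (fun z hz => (hd z hz).deriv) hz haC
  suffices n a = 0 by simpa [hn] using this
  by_contra hne
  refine ha.2 ?_
  have h1 := (tendsto_cauchyIntegral hγ hcont).eventually_ne (Ne.symm hne)
  rw [← Metric.cobounded_eq_cocompact] at h1
  rw [Bornology.isBounded_def]
  filter_upwards [h1] with z hz hzC
  exact hz (hconst z hzC)

lemma dslope_comm (g : ℂ → ℂ) (z w : ℂ) : dslope g z w = dslope g w z := by
  rcases eq_or_ne z w with rfl | h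
  · rfl
  · rw [dslope_of_ne _ h.symm, dslope_of_ne _ h, slope_comm]

lemma dslope_eq_sub_mul_inv (g : ℂ → ℂ) {z w : ℂ} (h : w ≠ z) :
    dslope g z w = g w * (w - z)⁻¹ - g z * (w - z)⁻¹ := by
  rw [dslope_of_ne _ h, slope_def_field, div_eq_mul_inv, sub_mul]

lemma contourIntegral_dslope (hγ : AbsolutelyContinuousOnInterval γ.extend 0 1) {g : ℂ → ℂ}
    (hg : ContinuousOn g (range γ)) {a : ℂ} (ha : a ∉ range γ) :
    contourIntegral γ (dslope g a) = contourIntegral γ (fun w => g w * (w - a)⁻¹) -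
      g a * contourIntegral γ (fun w => (w - a)⁻¹) := by
  have h1 : ContinuousOn (fun w => g w * (w - a)⁻¹) (range γ) := hg.mul (continuousOn_inv_sub ha)
  have h2 : ContinuousOn (fun w => g a * (w - a)⁻¹) (range γ) :=
    continuousOn_const.mul (continuousOn_inv_sub ha)
  rw [← contourIntegral_const_mul, ← contourIntegral_sub hγ h1 h2]
  exact contourIntegral_congr fun w hw => dslope_eq_sub_mul_inv g fun h => ha (h ▸ hw)

/-- If `w` lies within `3 * r` of `a`, the mean value inequality bounds the slope; otherwise `‖z -
w‖ ≥ r` bounds the denominator from below. -/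
lemma exists_norm_dslope_le {U K : Set ℂ} (hU : IsOpen U) (hK : IsCompact K) (hKU : K ⊆ U)
    {g : ℂ → ℂ} (hg : DifferentiableOn ℂ g U) {a : ℂ} {r : ℝ} (hr : 0 < r)
    (har : Metric.closedBall a (3 * r) ⊆ U) :
    ∃ M, ∀ w ∈ K, ∀ z ∈ Metric.closedBall a (2 * r), ‖dslope g w z‖ ≤ M := by
  have hsub : Metric.closedBall a (2 * r) ⊆ Metric.closedBall a (3 * r) :=
    Metric.closedBall_subset_closedBall (by linarith)
  obtain ⟨C₁, hC₁⟩ := (isCompact_closedBall a (3 * r)).exists_bound_of_continuousOn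
    ((hg.deriv hU).continuousOn.mono har)
  obtain ⟨C₀, hC₀⟩ := (isCompact_closedBall a (3 * r)).exists_bound_of_continuousOn
    (hg.continuousOn.mono har)
  obtain ⟨C₂, hC₂⟩ := hK.exists_bound_of_continuousOn (hg.continuousOn.mono hKU)
  refine ⟨max C₁ ((C₀ + C₂) / r), fun w hw z hz => ?_⟩
  by_cases hw3 : w ∈ Metric.closedBall a (3 * r)
  · refine le_trans ?_ (le_max_left _ _)
    rcases eq_or_ne z w with rfl | hne
    · rw [dslope_same]; exact hC₁ z hw3
    · rw [dslope_of_ne _ hne, slope_def_field, norm_div,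
        div_le_iff₀ (norm_pos_iff.2 (sub_ne_zero.2 hne))]
      exact (convex_closedBall a (3 * r)).norm_image_sub_le_of_norm_deriv_le
        (fun y hy => hg.differentiableAt (hU.mem_nhds (har hy))) hC₁ hw3 (hsub hz)
  · refine le_trans ?_ (le_max_right _ _)
    have hd : r ≤ ‖z - w‖ := by
      rw [Metric.mem_closedBall, not_le, dist_comm] at hw3
      rw [Metric.mem_closedBall, dist_comm] at hz
      have := dist_triangle a z w
      rw [← dist_eq_norm]
      linarith
    have hne : z ≠ w := sub_ne_zero.1 (norm_pos_iff.1 (hr.trans_le hd))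
    rw [dslope_of_ne _ hne, slope_def_field, norm_div]
    have h0 : ‖g z - g w‖ ≤ C₀ + C₂ :=
      (norm_sub_le _ _).trans (add_le_add (hC₀ z (hsub hz)) (hC₂ w hw))
    exact div_le_div₀ ((norm_nonneg _).trans h0) h0 hr hd

/-- Off the closed set of times at which the path is at `a`, the quotient rule gives an explicit
measurable expression; on it the value is constant. -/
lemma aestronglyMeasurable_deriv_dslope {U : Set ℂ} (hU : IsOpen U) {g : ℂ → ℂ}
    (hg : DifferentiableOn ℂ g U) (hγU : range γ ⊆ U) {a : ℂ} (ha : a ∈ U) {μ : Measure ℝ} :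
    AEStronglyMeasurable (fun t => deriv (dslope g (γ.extend t)) a) μ := by
  have hga := hg.differentiableAt (hU.mem_nhds ha)
  have hγc := γ.continuous_extend
  have hgc := continuous_comp_extend (hg.continuousOn.mono hγU)
  have heq : (fun t => deriv (dslope g (γ.extend t)) a) = fun t =>
      if γ.extend t = a then deriv (dslope g a) a else
        (deriv g a * (a - γ.extend t) - (g a - g (γ.extend t))) / (a - γ.extend t) ^ 2 := by
    funext t
    split_ifs with h
    · rw [h]
    · have hne : a ≠ γ.extend t := Ne.symm h
      rw [(dslope_eventuallyEq_slope_of_ne g hne).deriv_eq]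
      have h1 : slope g (γ.extend t) = fun z => (g z - g (γ.extend t)) / (z - γ.extend t) := by
        funext z; rw [slope_def_field]
      rw [h1]
      have := (hga.hasDerivAt.sub_const (g (γ.extend t))).div
        ((hasDerivAt_id a).sub_const (γ.extend t)) (sub_ne_zero.2 hne)
      refine Eq.trans (HasDerivAt.deriv this) ?_
      simp
  rw [heq]
  refine Measurable.aestronglyMeasurable (Measurable.ite ?_ measurable_const ?_)
  · exact (isClosed_singleton.preimage hγc).measurableSet
  · have h1 := hγc.measurable
    have h2 := hgc.measurable
    exact ((measurable_const.mul (measurable_const.sub h1)).sub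
      (measurable_const.sub h2)).div ((measurable_const.sub h1).pow_const 2)

/-- By symmetry `dslope g z w` is holomorphic in `z` too, and Cauchy's estimate on circles of radius
`r` turns a uniform bound on it into the bound `M / r` needed to differentiate under the integral.
-/
lemma differentiableAt_contourIntegral_dslope (hγ : AbsolutelyContinuousOnInterval γ.extend 0 1)
    {U : Set ℂ} (hU : IsOpen U) {g : ℂ → ℂ} (hg : DifferentiableOn ℂ g U) (hγU : range γ ⊆ U)
    {a : ℂ} (ha : a ∈ U) :
    DifferentiableAt ℂ (fun z => contourIntegral γ (dslope g z)) a := by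
  obtain ⟨ε, hε, hεU⟩ := Metric.isOpen_iff.1 hU a ha
  set r := ε / 4 with hrdef
  have hr : 0 < r := by positivity
  have har : Metric.closedBall a (3 * r) ⊆ U :=
    (Metric.closedBall_subset_ball (by linarith)).trans hεU
  obtain ⟨M, hM⟩ := exists_norm_dslope_le hU (isCompact_range_path γ) hγU hg hr har
  have hballU : ∀ z ∈ Metric.ball a r, z ∈ U := fun z hz =>
    har (Metric.ball_subset_closedBall (Metric.ball_subset_ball (by linarith) hz))
  have hdw : ∀ w ∈ range γ, DifferentiableOn ℂ (dslope g w) U := fun w hw =>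
    (Complex.differentiableOn_dslope (hU.mem_nhds (hγU hw))).2 hg
  refine (hasDerivAt_contourIntegral (φ := fun z => dslope g z)
    (φ' := fun z w => deriv (dslope g w) z) (M := M / r) hγ
    (Metric.ball_mem_nhds a hr) ?_ ?_ ?_ ?_).differentiableAt
  · intro z hz
    exact ((continuousOn_dslope (hU.mem_nhds (hballU z hz))).2 ⟨hg.continuousOn,
      hg.differentiableAt (hU.mem_nhds (hballU z hz))⟩).mono hγU
  · intro z hz w hw
    have := ((hdw w hw).differentiableAt (hU.mem_nhds (hballU z hz))).hasDerivAt
    simpa only [dslope_comm g _ w] using this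
  · exact aestronglyMeasurable_deriv_dslope hU hg hγU ha
  · intro z hz w hw
    have hsub : Metric.closedBall z r ⊆ Metric.closedBall a (2 * r) :=
      Metric.closedBall_subset_closedBall' (by linarith [Metric.mem_ball.1 hz])
    refine Complex.norm_deriv_le_of_forall_mem_sphere_norm_le hr ?_ fun y hy =>
      hM w hw y (hsub (Metric.sphere_subset_closedBall hy))
    refine ((hdw w hw).mono (hsub.trans ((Metric.closedBall_subset_closedBall
      (by linarith)).trans har))).diffContOnCl_ball subset_rfl

/-- Dixon's form of Cauchy's theorem. -/
theorem contourIntegral_dslope_eq_zero (hγ : AbsolutelyContinuousOnInterval γ.extend 0 1)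
    {U : Set ℂ} (hU : IsOpen U) {g : ℂ → ℂ} (hg : DifferentiableOn ℂ g U) (hγU : range γ ⊆ U)
    (hU' : enclosedRegion γ ⊆ U) {a : ℂ} (ha : a ∈ U) :
    contourIntegral γ (dslope g a) = 0 := by
  classical
  have hgc := hg.continuousOn.mono hγU
  set k : ℂ → ℂ := fun z => contourIntegral γ fun w => g w * (w - z)⁻¹ with hk
  -- The two formulas agree on `U ∩ exteriorRegion γ`, where the winding number vanishes. Every
  -- point outside `U` is exterior, so `H` is entire; it tends to `0` at infinity, so it is zero by
  -- Liouville.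
  set H : ℂ → ℂ := fun z => if z ∈ U then contourIntegral γ (dslope g z) else k z with hH
  have hHU : ∀ z ∈ U, H z = contourIntegral γ (dslope g z) := fun z hz => if_pos hz
  have hHE : ∀ z ∈ exteriorRegion γ, H z = k z := by
    intro z hz
    by_cases hzU : z ∈ U
    · rw [hHU z hzU, contourIntegral_dslope hγ hgc hz.1,
        contourIntegral_inv_of_mem_exteriorRegion hγ hz, mul_zero, sub_zero]
    · exact if_neg hzU
  have hdiff : Differentiable ℂ H := by
    intro z
    by_cases hzU : z ∈ U
    · refine (differentiableAt_contourIntegral_dslope hγ hU hg hγU hzU).congr_of_eventuallyEq ?_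
      filter_upwards [hU.mem_nhds hzU] with w hw using hHU w hw
    · have hzE : z ∈ exteriorRegion γ :=
        ⟨fun h => hzU (hγU h), fun h => hzU (hU' ⟨fun h => hzU (hγU h), h⟩)⟩
      refine (hasDerivAt_cauchyIntegral hγ hgc hzE.1).differentiableAt.congr_of_eventuallyEq ?_
      filter_upwards [(isOpen_exteriorRegion γ).mem_nhds hzE] with w hw using hHE w hw
  have hlim : Tendsto H (cocompact ℂ) (𝓝 0) := by
    obtain ⟨R, hR0, hR⟩ := exists_norm_bound_range γ
    refine (tendsto_cauchyIntegral hγ hgc).congr' ?_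
    filter_upwards [(tendsto_norm_cocompact_atTop (E := ℂ)).eventually_gt_atTop R] with z hz
    exact (hHE z (mem_exteriorRegion_of_lt_norm hR0 hR hz)).symm
  rw [← hHU a ha]
  exact hdiff.apply_eq_of_tendsto_cocompact a hlim

/-- Cauchy's integral formula. -/
theorem contourIntegral_mul_inv_sub (hγ : AbsolutelyContinuousOnInterval γ.extend 0 1)
    {U : Set ℂ} (hU : IsOpen U) {g : ℂ → ℂ} (hg : DifferentiableOn ℂ g U) (hγU : range γ ⊆ U)
    (hU' : enclosedRegion γ ⊆ U) {a : ℂ} (ha : a ∈ U) (haγ : a ∉ range γ) :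
    contourIntegral γ (fun w => g w * (w - a)⁻¹) =
      g a * contourIntegral γ (fun w => (w - a)⁻¹) := by
  have h := contourIntegral_dslope_eq_zero hγ hU hg hγU hU' ha
  rw [contourIntegral_dslope hγ (hg.continuousOn.mono hγU) haγ] at h
  exact sub_eq_zero.1 h

end cauchy

/-! ### Cauchy's formula for derivatives and products of negative powers -/

lemma iteratedDeriv_dslope {g : ℂ → ℂ} {a : ℂ} (hg : AnalyticAt ℂ g a) (k : ℕ) :
    iteratedDeriv k (dslope g a) a / (k.factorial : ℂ) =
      iteratedDeriv (k + 1) g a / ((k + 1).factorial : ℂ) := by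
  have h1 := hg.hasFPowerSeriesAt.has_fpower_series_dslope_fslope
  have h2 := h1.analyticAt.hasFPowerSeriesAt.eq_formalMultilinearSeries h1
  have h3 := congrArg (fun p => FormalMultilinearSeries.coeff p k) h2
  simpa only [FormalMultilinearSeries.coeff_fslope, FormalMultilinearSeries.coeff_ofScalars]
    using h3

section residue

variable {x : ℂ} {γ : Path x x}

lemma IsPositiveJordanContour.contourIntegral_inv (hγ : IsPositiveJordanContour γ) {a : ℂ}
    (ha : a ∈ enclosedRegion γ) :
    contourIntegral γ (fun w => (w - a)⁻¹) = 2 * Real.pi * Complex.I := by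
  have h := hγ.positive a ha
  rw [windingNumber] at h
  have h2 : (2 * Real.pi * Complex.I : ℂ) ≠ 0 := Complex.two_pi_I_ne_zero
  rw [← mul_one (2 * Real.pi * Complex.I : ℂ), ← h, mul_inv_cancel_left₀ h2]

/-- Cauchy's integral formula for derivatives. -/
theorem contourIntegral_mul_inv_pow (hγ : IsPositiveJordanContour γ) {U : Set ℂ} (hU : IsOpen U)
    (hγU : range γ ⊆ U) (hU' : enclosedRegion γ ⊆ U) {a : ℂ} (ha : a ∈ enclosedRegion γ) (k : ℕ)
    {g : ℂ → ℂ} (hg : DifferentiableOn ℂ g U) :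
    contourIntegral γ (fun w => g w * ((w - a)⁻¹) ^ (k + 1)) =
      2 * Real.pi * Complex.I * (iteratedDeriv k g a / (k.factorial : ℂ)) := by
  induction k generalizing g with
  | zero =>
    simp only [zero_add, pow_one, iteratedDeriv_zero, Nat.factorial_zero, Nat.cast_one, div_one]
    rw [contourIntegral_mul_inv_sub hγ.absCont hU hg hγU hU' (hU' ha) ha.1,
      hγ.contourIntegral_inv ha, mul_comm]
  | succ k ih =>
    have hUa := hU.mem_nhds (hU' ha)
    have hd : DifferentiableOn ℂ (dslope g a) U := (Complex.differentiableOn_dslope hUa).2 hg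
    have hinv := continuousOn_inv_sub ha.1
    have h1 : ContinuousOn (fun w => g a * ((w - a)⁻¹) ^ (k + 2)) (range γ) :=
      continuousOn_const.mul (hinv.pow _)
    have h2 : ContinuousOn (fun w => dslope g a w * ((w - a)⁻¹) ^ (k + 1)) (range γ) :=
      (hd.continuousOn.mono hγU).mul (hinv.pow _)
    -- `dslope` shifts Taylor coefficients by one. In `g w = g a + (w - a) * dslope g a w` the
    -- constant meets a power of exponent at least `2` and integrates to zero.
    rw [← iteratedDeriv_dslope (hg.analyticAt hUa), ← ih hd]
    rw [contourIntegral_congr (h := fun w => g a * ((w - a)⁻¹) ^ (k + 2) +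
      dslope g a w * ((w - a)⁻¹) ^ (k + 1)), contourIntegral_add hγ.absCont h1 h2,
      contourIntegral_const_mul, contourIntegral_inv_pow hγ.absCont ha.1 (by omega), mul_zero,
      zero_add]
    intro w hw
    have hne := sub_ne_zero_of_notMem_range ha.1 hw
    have := sub_smul_dslope g a w
    rw [smul_eq_mul] at this
    have h3 : g w = g a + (w - a) * dslope g a w := by rw [this]; ring
    simp only
    rw [h3, add_mul, pow_succ _ (k + 1)]
    field_simp

/-- A product of negative powers at two distinct enclosed points has vanishing integral. -/
theorem contourIntegral_inv_pow_mul_inv_pow (hγ : IsPositiveJordanContour γ) {a b : ℂ}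
    (ha : a ∈ enclosedRegion γ) (hb : b ∈ enclosedRegion γ) (hab : a ≠ b) (l n : ℕ) :
    contourIntegral γ (fun w => ((w - a)⁻¹) ^ (l + 1) * ((w - b)⁻¹) ^ (n + 1)) = 0 := by
  have hca := continuousOn_inv_sub ha.1
  have hcb := continuousOn_inv_sub hb.1
  have hc : ∀ l n : ℕ, ContinuousOn (fun w => ((w - a)⁻¹) ^ l * ((w - b)⁻¹) ^ n) (range γ) :=
    fun l n => (hca.pow l).mul (hcb.pow n)
  -- Partial fractions: each term on the right has one exponent lowered by one.
  have hsplit : ∀ l n : ℕ,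
      contourIntegral γ (fun w => ((w - a)⁻¹) ^ (l + 1) * ((w - b)⁻¹) ^ (n + 1)) =
      (a - b)⁻¹ * (contourIntegral γ (fun w => ((w - a)⁻¹) ^ (l + 1) * ((w - b)⁻¹) ^ n) -
        contourIntegral γ (fun w => ((w - a)⁻¹) ^ l * ((w - b)⁻¹) ^ (n + 1))) := by
    intro l n
    rw [← contourIntegral_sub hγ.absCont (hc _ _) (hc _ _), ← contourIntegral_const_mul]
    refine contourIntegral_congr fun w hw => ?_
    have h1 := sub_ne_zero_of_notMem_range ha.1 hw
    have h2 := sub_ne_zero_of_notMem_range hb.1 hw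
    have h3 := sub_ne_zero.2 hab
    simp only [pow_succ]
    field_simp
    ring
  have hA : ∀ l, contourIntegral γ (fun w => ((w - a)⁻¹) ^ (l + 1) * ((w - b)⁻¹) ^ 0) =
      if l = 0 then 2 * Real.pi * Complex.I else 0 := by
    intro l
    simp only [pow_zero, mul_one]
    split_ifs with h
    · subst h; simpa using hγ.contourIntegral_inv ha
    · exact contourIntegral_inv_pow hγ.absCont ha.1 (by omega)
  have hB : ∀ n, contourIntegral γ (fun w => ((w - a)⁻¹) ^ 0 * ((w - b)⁻¹) ^ (n + 1)) =
      if n = 0 then 2 * Real.pi * Complex.I else 0 := by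
    intro n
    simp only [pow_zero, one_mul]
    split_ifs with h
    · subst h; simpa using hγ.contourIntegral_inv hb
    · exact contourIntegral_inv_pow hγ.absCont hb.1 (by omega)
  -- At `l = n = 0` the two remaining integrals are both `2πi` and cancel; this is where both points
  -- must be enclosed.
  induction l generalizing n with
  | zero =>
    induction n with
    | zero => rw [hsplit, hA, hB]; simp
    | succ n ih => rw [hsplit, ih, hB]; simp
  | succ l ihl =>
    induction n with
    | zero => rw [hsplit, hA, ihl]; simp
    | succ n ih => rw [hsplit, ih, ihl]; simp

end residue

/-! ### Principal parts and the regular part -/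

/-- The principal part of `f` at `w`, where `f` has a pole of order `d`. -/
noncomputable def principalPart (f : ℂ → ℂ) (w : ℂ) (d : ℕ) (ζ : ℂ) : ℂ :=
  ∑ l ∈ Finset.Icc 1 d,
    iteratedDeriv (d - l) (poleRemoved f w d) w / ((d - l).factorial : ℂ) * ((ζ - w)⁻¹) ^ l

lemma analyticAt_inv_sub {w ζ : ℂ} (h : ζ ≠ w) : AnalyticAt ℂ (fun z => (z - w)⁻¹) ζ :=
  (analyticAt_id.sub analyticAt_const).inv (sub_ne_zero.2 h)

lemma analyticAt_principalPart (f : ℂ → ℂ) {w ζ : ℂ} (d : ℕ) (h : ζ ≠ w) :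
    AnalyticAt ℂ (principalPart f w d) ζ :=
  Finset.analyticAt_fun_sum _ fun _ _ => analyticAt_const.mul ((analyticAt_inv_sub h).pow _)

lemma analyticAt_poleRemoved {f : ℂ → ℂ} {w : ℂ} {d : ℕ} (hf : MeromorphicAt f w)
    (hd : meromorphicOrderAt f w = ((-(d : ℤ) : ℤ) : WithTop ℤ)) :
    AnalyticAt ℂ (poleRemoved f w d) w := by
  obtain ⟨F, hF, -, hfF⟩ := (meromorphicOrderAt_eq_int_iff hf).1 hd
  have h1 : (fun z => (z - w) ^ d * f z) =ᶠ[𝓝[≠] w] F := by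
    filter_upwards [hfF, self_mem_nhdsWithin] with z hz hzw
    have : z - w ≠ 0 := sub_ne_zero.2 hzw
    simp only [hz, zpow_neg, zpow_natCast, smul_eq_mul]
    field_simp
  have hlim : limUnder (𝓝[≠] w) (fun z => (z - w) ^ d * f z) = F w :=
    ((hF.continuousAt.tendsto.mono_left nhdsWithin_le_nhds).congr' h1.symm).limUnder_eq
  refine hF.congr ?_
  rw [EventuallyEq, eventually_nhdsWithin_iff] at h1
  filter_upwards [h1] with z hz
  rcases eq_or_ne z w with rfl | hne
  · simp [poleRemoved, hlim]
  · rw [poleRemoved, Function.update_of_ne hne, hz hne]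

/-- Expand `(z - w) ^ d * f z` by Taylor to order `d` and divide by `(z - w) ^ d`: the polynomial
becomes the principal part, the remainder becomes `H`. -/
lemma exists_analyticAt_sub_principalPart {f : ℂ → ℂ} {w : ℂ} {d : ℕ} (hf : MeromorphicAt f w)
    (hd : meromorphicOrderAt f w = ((-(d : ℤ) : ℤ) : WithTop ℤ)) :
    ∃ H : ℂ → ℂ, AnalyticAt ℂ H w ∧ ∀ᶠ z in 𝓝[≠] w, f z - principalPart f w d z = H z := by
  have hF := analyticAt_poleRemoved hf hd
  have hF0 : AnalyticAt ℂ (fun u => poleRemoved f w d (w + u)) 0 :=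
    AnalyticAt.comp_of_eq hF (analyticAt_const.add analyticAt_id) (by simp)
  obtain ⟨H, hH, hFH⟩ := hF0.exists_eq_sum_add_pow_mul d
  refine ⟨fun z => H (z - w),
    hH.comp_of_eq (analyticAt_id.sub analyticAt_const) (by simp), ?_⟩
  filter_upwards [self_mem_nhdsWithin] with z hzw
  have hne : z - w ≠ 0 := sub_ne_zero.2 hzw
  have h1 := hFH (z - w)
  simp only [iteratedDeriv_comp_const_add, add_zero, add_sub_cancel, smul_eq_mul] at h1
  rw [poleRemoved, Function.update_of_ne hzw, ← poleRemoved] at h1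
  have h2 : f z = ((z - w)⁻¹) ^ d * ((z - w) ^ d * f z) := by
    rw [← mul_assoc, ← mul_pow, inv_mul_cancel₀ hne, one_pow, one_mul]
  have h3 : principalPart f w d z = ((z - w)⁻¹) ^ d * ∑ i ∈ Finset.range d,
      (z - w) ^ i / (i.factorial : ℂ) * iteratedDeriv i (poleRemoved f w d) w := by
    rw [principalPart, Finset.mul_sum]
    refine Finset.sum_nbij' (fun l => d - l) (fun i => d - i) ?_ ?_ ?_ ?_ ?_
    · intro l hl; simp only [Finset.mem_Icc, Finset.mem_range] at *; omega
    · intro l hl; simp only [Finset.mem_Icc, Finset.mem_range] at *; omega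
    · intro l hl; simp only [Finset.mem_Icc] at *; omega
    · intro l hl; simp only [Finset.mem_range] at *; omega
    · intro l hl
      have hld := (Finset.mem_Icc.1 hl).2
      have h4 : ((z - w)⁻¹) ^ d = ((z - w)⁻¹) ^ l * ((z - w)⁻¹) ^ (d - l) := by
        rw [← pow_add, Nat.add_sub_cancel' hld]
      have h5 : ((z - w)⁻¹) ^ (d - l) * (z - w) ^ (d - l) = 1 := by
        rw [← mul_pow, inv_mul_cancel₀ hne, one_pow]
      rw [h4]
      linear_combination (-(((z - w)⁻¹) ^ l * iteratedDeriv (d - l) (poleRemoved f w d) w /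
        ((d - l).factorial : ℂ))) * h5
  rw [h3, h2, h1, mul_add, add_sub_cancel_left, ← mul_assoc, ← mul_pow, inv_mul_cancel₀ hne,
    one_pow, one_mul]

section regular

variable {t : ℕ} (f : ℂ → ℂ) (z : Fin t → ℂ) (d : Fin t → ℕ)

/-- `f` minus its principal parts at the points `z j`. -/
noncomputable def regularPart (ζ : ℂ) : ℂ := f ζ - ∑ j, principalPart f (z j) (d j) ζ

open Classical in
/-- The regular part of `f`, extended to the points `z j` by its limits there. -/
noncomputable def regularPartExt (w : ℂ) : ℂ :=
  if w ∈ range z then limUnder (𝓝[≠] w) (regularPart f z d) else regularPart f z d w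

variable {f z d}

lemma analyticAt_regularPart {w : ℂ} (hf : AnalyticAt ℂ f w) (hw : w ∉ range z) :
    AnalyticAt ℂ (regularPart f z d) w :=
  hf.sub (Finset.analyticAt_fun_sum _ fun j _ =>
    analyticAt_principalPart f (d j) fun h => hw ⟨j, h.symm⟩)

lemma regularPartExt_eventuallyEq_of_notMem {w : ℂ} (hw : w ∉ range z) :
    regularPartExt f z d =ᶠ[𝓝 w] regularPart f z d := by
  filter_upwards [(finite_range z).isClosed.isOpen_compl.mem_nhds hw] with y hy
  exact if_neg hy

lemma analyticAt_regularPartExt_of_notMem {w : ℂ} (hf : AnalyticAt ℂ f w) (hw : w ∉ range z) :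
    AnalyticAt ℂ (regularPartExt f z d) w :=
  (analyticAt_regularPart hf hw).congr (regularPartExt_eventuallyEq_of_notMem hw).symm

/-- The `j`-th principal part removes the singularity at `z j`; the others are analytic there
because the points are distinct. -/
lemma analyticAt_regularPartExt_pole (hz : Function.Injective z) (j : Fin t)
    (hf : MeromorphicAt f (z j))
    (hd : meromorphicOrderAt f (z j) = ((-(d j : ℤ) : ℤ) : WithTop ℤ)) :
    AnalyticAt ℂ (regularPartExt f z d) (z j) := by
  obtain ⟨H, hH, hfH⟩ := exists_analyticAt_sub_principalPart hf hd
  set S : ℂ → ℂ := fun ζ => ∑ i ∈ Finset.univ.erase j, principalPart f (z i) (d i) ζ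
  have hS : AnalyticAt ℂ S (z j) := Finset.analyticAt_fun_sum _ fun i hi =>
    analyticAt_principalPart f (d i) fun h => (Finset.ne_of_mem_erase hi) (hz h).symm
  have hHS := hH.sub hS
  have h1 : regularPart f z d =ᶠ[𝓝[≠] z j] H - S := by
    filter_upwards [hfH] with ζ hζ
    rw [regularPart, ← Finset.add_sum_erase _ _ (Finset.mem_univ j), ← sub_sub, hζ]
    rfl
  have hlim : limUnder (𝓝[≠] z j) (regularPart f z d) = (H - S) (z j) :=
    ((hHS.continuousAt.tendsto.mono_left nhdsWithin_le_nhds).congr' h1.symm).limUnder_eq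
  refine hHS.congr ?_
  have hfin : (range z \ {z j})ᶜ ∈ 𝓝 (z j) :=
    ((finite_range z).subset sdiff_subset).isClosed.isOpen_compl.mem_nhds fun h => h.2 rfl
  rw [EventuallyEq, eventually_nhdsWithin_iff] at h1
  filter_upwards [h1, hfin] with ζ hζ hζ'
  rcases eq_or_ne ζ (z j) with rfl | hne
  · rw [regularPartExt, if_pos (mem_range_self j), hlim]
  · rw [regularPartExt, if_neg fun h => hζ' ⟨h, hne⟩, hζ hne]

lemma regularPart_add_sum (ζ : ℂ) :
    f ζ = regularPart f z d ζ + ∑ j, principalPart f (z j) (d j) ζ := by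
  rw [regularPart, sub_add_cancel]

end regular

/-- The contour integral of a meromorphic function against a negative power at a regular point is
given by the Taylor coefficient of its regular part. -/
theorem contourIntegral_meromorphic_mul_inv_pow {t : ℕ} {D : Set ℂ} {f : ℂ → ℂ}
    (hf : IsMeromorphicFunctionOn f D) {x : ℂ} {γ : Path x x} (hγ : IsPositiveJordanContour γ)
    (hγD : range γ ⊆ D) (hγD' : enclosedRegion γ ⊆ D) (hγf : Disjoint (range γ) (polesIn f D))
    {z : Fin t → ℂ} (hz : Function.Injective z) (hzγ : range z = polesIn f D ∩ enclosedRegion γ)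
    {d : Fin t → ℕ}
    (hd : ∀ j, meromorphicOrderAt f (z j) = ((-(d j : ℤ) : ℤ) : WithTop ℤ))
    {a : ℂ} (ha : a ∈ enclosedRegion γ) (haf : a ∉ polesIn f D) (k : ℕ) :
    contourIntegral γ (fun w => f w * ((w - a)⁻¹) ^ (k + 1)) =
      2 * Real.pi * Complex.I * (iteratedDeriv k (regularPart f z d) a / (k.factorial : ℂ)) := by
  have hz_mem : ∀ j, z j ∈ polesIn f D ∩ enclosedRegion γ := fun j => hzγ ▸ mem_range_self j
  have haz : a ∉ range z := fun h => haf (hzγ ▸ h : a ∈ polesIn f D ∩ enclosedRegion γ).1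
  have hγz : ∀ w ∈ range γ, w ∉ range z := fun w hw h =>
    (hzγ ▸ h : w ∈ polesIn f D ∩ enclosedRegion γ).2.1 hw
  have hγan : ∀ w ∈ range γ, AnalyticAt ℂ f w := fun w hw =>
    hf.holomorphic w ⟨hγD hw, fun h => disjoint_left.1 hγf hw h⟩
  set G := regularPartExt f z d with hG
  set U := {w | AnalyticAt ℂ G w} with hUdef
  have hU : IsOpen U := isOpen_analyticAt ℂ G
  have hγU : range γ ⊆ U := fun w hw => analyticAt_regularPartExt_of_notMem (hγan w hw) (hγz w hw)
  have hU' : enclosedRegion γ ⊆ U := by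
    intro w hw
    by_cases hwz : w ∈ range z
    · obtain ⟨j, rfl⟩ := hwz
      exact analyticAt_regularPartExt_pole hz j (hf.meromorphic _ (hz_mem j).1.1) (hd j)
    · exact analyticAt_regularPartExt_of_notMem (hf.holomorphic w ⟨hγD' hw, fun h =>
        hwz (hzγ ▸ ⟨h, hw⟩)⟩) hwz
  have hGd : DifferentiableOn ℂ G U := fun w hw => AnalyticAt.differentiableWithinAt hw
  have hinv := continuousOn_inv_sub ha.1
  have hterm : ∀ j l, ContinuousOn (fun w =>
      iteratedDeriv (d j - l) (poleRemoved f (z j) (d j)) (z j) / ((d j - l).factorial : ℂ) *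
        (((w - z j)⁻¹) ^ l * ((w - a)⁻¹) ^ (k + 1))) (range γ) := fun j l =>
    continuousOn_const.mul (((continuousOn_inv_sub (hz_mem j).2.1).pow _).mul (hinv.pow _))
  have hGc : ContinuousOn (fun w => G w * ((w - a)⁻¹) ^ (k + 1)) (range γ) :=
    (hGd.continuousOn.mono hγU).mul (hinv.pow _)
  -- On the curve `f` is `G` plus its principal parts. `G` gives the Taylor coefficient; the
  -- remaining double sum vanishes term by term since `a` differs from every `z j`.
  rw [contourIntegral_congr (h := fun w => G w * ((w - a)⁻¹) ^ (k + 1) +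
    ∑ j, ∑ l ∈ Finset.Icc 1 (d j),
      iteratedDeriv (d j - l) (poleRemoved f (z j) (d j)) (z j) / ((d j - l).factorial : ℂ) *
        (((w - z j)⁻¹) ^ l * ((w - a)⁻¹) ^ (k + 1))),
    contourIntegral_add hγ.absCont hGc (continuousOn_finsetSum _ fun j _ =>
      continuousOn_finsetSum _ fun l _ => hterm j l),
    contourIntegral_mul_inv_pow hγ hU hγU hU' ha k hGd,
    (regularPartExt_eventuallyEq_of_notMem haz).iteratedDeriv_eq,
    contourIntegral_finset_sum hγ.absCont _ fun j _ =>
      continuousOn_finsetSum _ fun l _ => hterm j l, Finset.sum_eq_zero, add_zero]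
  · intro j _
    rw [contourIntegral_finset_sum hγ.absCont _ fun l _ => hterm j l]
    refine Finset.sum_eq_zero fun l hl => ?_
    obtain ⟨l, rfl⟩ : ∃ n, l = n + 1 := ⟨l - 1, by have := (Finset.mem_Icc.1 hl).1; omega⟩
    rw [contourIntegral_const_mul, contourIntegral_inv_pow_mul_inv_pow hγ (hz_mem j).2 ha
      (fun h => haz ⟨j, h⟩), mul_zero]
  · intro w hw
    simp only
    rw [hG, (regularPartExt_eventuallyEq_of_notMem (hγz w hw)).eq_of_nhds,
      regularPart_add_sum (f := f) (z := z) (d := d) w, add_mul, Finset.sum_mul]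
    simp only [principalPart, Finset.sum_mul, mul_assoc]

/-! ### Functions of a single Jordan block -/

lemma iteratedDeriv_mul_div_factorial {f g : ℂ → ℂ} {a : ℂ} (hf : AnalyticAt ℂ f a)
    (hg : AnalyticAt ℂ g a) (n : ℕ) :
    iteratedDeriv n (fun z => f z * g z) a / (n.factorial : ℂ) =
      ∑ i ∈ Finset.range (n + 1), iteratedDeriv i f a / (i.factorial : ℂ) *
        (iteratedDeriv (n - i) g a / ((n - i).factorial : ℂ)) := by
  rw [iteratedDeriv_fun_mul hf.contDiffAt hg.contDiffAt, Finset.sum_div]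
  refine Finset.sum_congr rfl fun i hi => ?_
  have hin : i ≤ n := Nat.lt_succ_iff.1 (Finset.mem_range.1 hi)
  have h1 : (n.factorial : ℂ) ≠ 0 := Nat.cast_ne_zero.2 n.factorial_ne_zero
  have h2 : (i.factorial : ℂ) ≠ 0 := Nat.cast_ne_zero.2 i.factorial_ne_zero
  have h3 : ((n - i).factorial : ℂ) ≠ 0 := Nat.cast_ne_zero.2 (n - i).factorial_ne_zero
  rw [Nat.cast_choose ℂ hin]
  field_simp

lemma jordanBlockFun_congr {f g : ℂ → ℂ} {a : ℂ} (h : f =ᶠ[𝓝 a] g) (n : ℕ) :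
    jordanBlockFun f a n = jordanBlockFun g a n := by
  ext i j
  simp only [jordanBlockFun, Matrix.of_apply, h.iteratedDeriv_eq]

lemma jordanBlockFun_add {f g : ℂ → ℂ} {a : ℂ} (hf : AnalyticAt ℂ f a) (hg : AnalyticAt ℂ g a)
    (n : ℕ) : jordanBlockFun (fun z => f z + g z) a n =
      jordanBlockFun f a n + jordanBlockFun g a n := by
  ext i j
  simp only [jordanBlockFun, Matrix.of_apply, Matrix.add_apply,
    iteratedDeriv_fun_add hf.contDiffAt hg.contDiffAt]
  split_ifs <;> ring

lemma jordanBlockFun_const_mul (c : ℂ) (f : ℂ → ℂ) (a : ℂ) (n : ℕ) :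
    jordanBlockFun (fun z => c * f z) a n = c • jordanBlockFun f a n := by
  ext i j
  simp only [jordanBlockFun, Matrix.of_apply, Matrix.smul_apply, iteratedDeriv_const_mul_field,
    smul_eq_mul]
  split_ifs <;> ring

lemma jordanBlockFun_const (c a : ℂ) (n : ℕ) : jordanBlockFun (fun _ => c) a n = c • 1 := by
  ext i j
  simp only [jordanBlockFun, Matrix.of_apply, Matrix.smul_apply, Matrix.one_apply,
    iteratedDeriv_const, smul_eq_mul, mul_ite, mul_one, mul_zero]
  rcases lt_trichotomy i j with h | h | h
  · have : (j : ℕ) - i ≠ 0 := by have : (i : ℕ) < j := h; omega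
    simp [h.ne, this]
  · simp [h]
  · simp [h.not_ge, h.ne']

lemma jordanBlockFun_id (a : ℂ) (n : ℕ) : jordanBlockFun (fun z => z) a n = jordanBlock a n := by
  ext i j
  simp only [jordanBlockFun, jordanBlock, Matrix.of_apply, iteratedDeriv_fun_id]
  rcases lt_trichotomy i j with h | h | h
  · have h' : (i : ℕ) < j := h
    have h0 : (j : ℕ) - i ≠ 0 := by omega
    by_cases h1 : (j : ℕ) = i + 1
    · have : (j : ℕ) - i = 1 := by omega
      simp [h.ne, h.le, h1]
    · have : (j : ℕ) - i ≠ 1 := by omega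
      simp [h.ne, h0, this, h1]
  · simp [h]
  · have h' : (j : ℕ) < i := h
    have : (j : ℕ) ≠ i + 1 := by omega
    simp [h.not_ge, h.ne', this]

/-- Upper triangular Toeplitz matrices multiply by the Cauchy product of their symbols, and so do
Taylor coefficients by Leibniz's rule. -/
lemma jordanBlockFun_mul {f g : ℂ → ℂ} {a : ℂ} (hf : AnalyticAt ℂ f a) (hg : AnalyticAt ℂ g a)
    (n : ℕ) : jordanBlockFun (fun z => f z * g z) a n =
      jordanBlockFun f a n * jordanBlockFun g a n := by
  ext i j
  simp only [jordanBlockFun, Matrix.of_apply, Matrix.mul_apply]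
  set F : ℕ → ℂ := fun k => iteratedDeriv k f a / (k.factorial : ℂ)
  set G : ℕ → ℂ := fun k => iteratedDeriv k g a / (k.factorial : ℂ)
  have hterm : ∀ k : Fin n, ((if i ≤ k then F (k - i) else 0) * if k ≤ j then G (j - k) else 0) =
      (fun k : ℕ => if k ∈ Finset.Ico (i : ℕ) (j + 1) then F (k - i) * G (j - k) else 0) k := by
    intro k
    simp only [Finset.mem_Ico, Fin.le_def, Nat.lt_succ_iff]
    split_ifs <;> simp_all
  rw [Finset.sum_congr rfl fun k _ => hterm k, Fin.sum_univ_eq_sum_range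
    (fun k : ℕ => if k ∈ Finset.Ico (i : ℕ) (j + 1) then F (k - i) * G (j - k) else 0) n,
    Finset.sum_ite_mem,
    Finset.inter_eq_right.2 fun k hk => Finset.mem_range.2
      (by have := (Finset.mem_Ico.1 hk).2; omega), Finset.sum_Ico_eq_sum_range]
  split_ifs with h
  · have h' : (i : ℕ) ≤ j := h
    rw [iteratedDeriv_mul_div_factorial hf hg, show (j : ℕ) + 1 - i = j - i + 1 by omega]
    refine Finset.sum_congr rfl fun k _ => ?_
    simp only [F, G, Nat.add_sub_cancel_left, Nat.sub_add_eq]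
  · have h' : (j : ℕ) < i := not_le.1 h
    rw [show (j : ℕ) + 1 - i = 0 by omega, Finset.sum_range_zero]

lemma jordanBlockFun_const_sub (w a : ℂ) (n : ℕ) :
    jordanBlockFun (fun ζ => w - ζ) a n = w • 1 - jordanBlock a n := by
  have h : (fun ζ : ℂ => w - ζ) = fun ζ => w + (-1) * ζ := by funext ζ; ring
  have h1 : AnalyticAt ℂ (fun ζ : ℂ => (-1) * ζ) a := analyticAt_const.mul analyticAt_id
  rw [h, jordanBlockFun_add analyticAt_const h1, jordanBlockFun_const, jordanBlockFun_const_mul,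
    jordanBlockFun_id, neg_one_smul, sub_eq_add_neg]

/-- Near `a`, passing to `dslope` multiplies this function by `(w - a)⁻¹`, so the Taylor
coefficients are geometric. -/
lemma iteratedDeriv_inv_const_sub {w a : ℂ} (h : a ≠ w) (k : ℕ) :
    iteratedDeriv k (fun ζ => (w - ζ)⁻¹) a / (k.factorial : ℂ) = ((w - a)⁻¹) ^ (k + 1) := by
  have hwa : w - a ≠ 0 := sub_ne_zero.2 h.symm
  have han : AnalyticAt ℂ (fun ζ => (w - ζ)⁻¹) a :=
    (analyticAt_const.sub analyticAt_id).inv hwa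
  induction k with
  | zero => simp
  | succ k ih =>
    have hd : dslope (fun ζ => (w - ζ)⁻¹) a =ᶠ[𝓝 a] fun ζ => (w - a)⁻¹ * (w - ζ)⁻¹ := by
      filter_upwards [isOpen_ne.mem_nhds h] with ζ hζ
      have hwz : w - ζ ≠ 0 := sub_ne_zero.2 (Ne.symm hζ)
      rcases eq_or_ne ζ a with rfl | hne
      · rw [dslope_same]
        have := ((hasDerivAt_id ζ).const_sub w).inv hwa
        refine (HasDerivAt.deriv this).trans ?_
        simp only [id]
        field_simp
      · rw [dslope_of_ne _ hne, slope_def_field]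
        have := sub_ne_zero.2 hne
        field_simp
        ring
    rw [← iteratedDeriv_dslope han, hd.iteratedDeriv_eq, iteratedDeriv_const_mul_field,
      mul_div_assoc, ih, pow_succ' _ (k + 1)]

/-! ### The functional calculus of a Jordan form -/

namespace JordanForm

variable {m : ℕ} {A : Matrix (Fin m) (Fin m) ℂ} (J : JordanForm A)

/-- The matrix with the given diagonal blocks in the Jordan basis. -/
noncomputable def ofBlocks (M : ∀ k, Matrix (Fin (J.size k)) (Fin (J.size k)) ℂ) :
    Matrix (Fin m) (Fin m) ℂ :=
  J.V * Matrix.reindex J.index J.index (Matrix.blockDiagonal' M) * J.V⁻¹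

lemma V_mul_inv : J.V * J.V⁻¹ = 1 :=
  Matrix.mul_nonsing_inv _ ((Matrix.isUnit_iff_isUnit_det _).1 J.isUnit_V)

lemma inv_mul_V : J.V⁻¹ * J.V = 1 :=
  Matrix.nonsing_inv_mul _ ((Matrix.isUnit_iff_isUnit_det _).1 J.isUnit_V)

lemma ofBlocks_mul (M N : ∀ k, Matrix (Fin (J.size k)) (Fin (J.size k)) ℂ) :
    J.ofBlocks (fun k => M k * N k) = J.ofBlocks M * J.ofBlocks N := by
  have h : Matrix.reindex J.index J.index (Matrix.blockDiagonal' fun k => M k * N k) =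
      Matrix.reindex J.index J.index (Matrix.blockDiagonal' M) *
        Matrix.reindex J.index J.index (Matrix.blockDiagonal' N) := by
    rw [Matrix.blockDiagonal'_mul]
    exact (Matrix.submatrix_mul_equiv _ _ _ _ _).symm
  simp only [ofBlocks, h, Matrix.mul_assoc]
  rw [← Matrix.mul_assoc J.V⁻¹ J.V, J.inv_mul_V, Matrix.one_mul]

lemma ofBlocks_one : J.ofBlocks (fun _ => 1) = 1 := by
  have h : Matrix.blockDiagonal' (fun k => (1 : Matrix (Fin (J.size k)) (Fin (J.size k)) ℂ)) = 1 :=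
    Matrix.blockDiagonal'_one
  simp [ofBlocks, h, J.V_mul_inv]

lemma ofBlocks_add (M N : ∀ k, Matrix (Fin (J.size k)) (Fin (J.size k)) ℂ) :
    J.ofBlocks (fun k => M k + N k) = J.ofBlocks M + J.ofBlocks N := by
  have h : Matrix.blockDiagonal' (fun k => M k + N k) =
      Matrix.blockDiagonal' M + Matrix.blockDiagonal' N := Matrix.blockDiagonal'_add M N
  simp [ofBlocks, h, Matrix.submatrix_add, Matrix.mul_add, Matrix.add_mul]

lemma ofBlocks_smul (c : ℂ) (M : ∀ k, Matrix (Fin (J.size k)) (Fin (J.size k)) ℂ) :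
    J.ofBlocks (fun k => c • M k) = c • J.ofBlocks M := by
  have h : Matrix.blockDiagonal' (fun k => c • M k) = c • Matrix.blockDiagonal' M :=
    Matrix.blockDiagonal'_smul c M
  simp [ofBlocks, h, Matrix.submatrix_smul]

lemma ofBlocks_zero : J.ofBlocks (fun _ => 0) = 0 := by
  simpa using J.ofBlocks_smul 0 (fun _ => 0)

lemma ofBlocks_injective : Function.Injective J.ofBlocks := by
  intro M N h
  have h1 := congrArg (fun X => J.V⁻¹ * X * J.V) h
  simp only [ofBlocks, Matrix.mul_assoc, J.inv_mul_V, Matrix.mul_one] at h1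
  simp only [← Matrix.mul_assoc, J.inv_mul_V, Matrix.one_mul] at h1
  exact Matrix.blockDiagonal'_injective ((Matrix.reindex J.index J.index).injective h1)

lemma ofBlocks_jordanBlock :
    J.ofBlocks (fun k => jordanBlock (J.eigenvalue k) (J.size k)) = A := by
  rw [ofBlocks, ← J.conj_eq, Matrix.mul_assoc, Matrix.mul_assoc, J.V_mul_inv, Matrix.mul_one,
    ← Matrix.mul_assoc, J.V_mul_inv, Matrix.one_mul]

lemma apply_eq_ofBlocks (f : ℂ → ℂ) :
    J.apply f = J.ofBlocks fun k => jordanBlockFun f (J.eigenvalue k) (J.size k) := rfl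

variable {J}

lemma apply_congr {f g : ℂ → ℂ} (h : ∀ k, f =ᶠ[𝓝 (J.eigenvalue k)] g) :
    J.apply f = J.apply g := by
  simp only [apply_eq_ofBlocks, jordanBlockFun_congr (h _)]

lemma apply_add {f g : ℂ → ℂ} (hf : ∀ k, AnalyticAt ℂ f (J.eigenvalue k))
    (hg : ∀ k, AnalyticAt ℂ g (J.eigenvalue k)) :
    J.apply (fun z => f z + g z) = J.apply f + J.apply g := by
  simp only [apply_eq_ofBlocks, jordanBlockFun_add (hf _) (hg _), ofBlocks_add]

lemma apply_mul {f g : ℂ → ℂ} (hf : ∀ k, AnalyticAt ℂ f (J.eigenvalue k))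
    (hg : ∀ k, AnalyticAt ℂ g (J.eigenvalue k)) :
    J.apply (fun z => f z * g z) = J.apply f * J.apply g := by
  simp only [apply_eq_ofBlocks, jordanBlockFun_mul (hf _) (hg _), ofBlocks_mul]

variable (J)

lemma apply_const_mul (c : ℂ) (f : ℂ → ℂ) : J.apply (fun z => c * f z) = c • J.apply f := by
  simp only [apply_eq_ofBlocks, jordanBlockFun_const_mul, ofBlocks_smul]

lemma apply_const (c : ℂ) : J.apply (fun _ => c) = c • 1 := by
  simp only [apply_eq_ofBlocks, jordanBlockFun_const, ofBlocks_smul, ofBlocks_one]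

lemma apply_const_sub (w : ℂ) : J.apply (fun ζ => w - ζ) = w • 1 - A := by
  have h : ∀ k, jordanBlockFun (fun ζ => w - ζ) (J.eigenvalue k) (J.size k) =
      w • 1 + (-1 : ℂ) • jordanBlock (J.eigenvalue k) (J.size k) := fun k => by
    rw [jordanBlockFun_const_sub, neg_one_smul, sub_eq_add_neg]
  simp only [apply_eq_ofBlocks, h]
  rw [ofBlocks_add, ofBlocks_smul, ofBlocks_smul, ofBlocks_one, ofBlocks_jordanBlock, neg_one_smul,
    sub_eq_add_neg]

variable {J}

lemma apply_finset_sum {ι : Type*} (s : Finset ι) {f : ι → ℂ → ℂ}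
    (hf : ∀ i ∈ s, ∀ k, AnalyticAt ℂ (f i) (J.eigenvalue k)) :
    J.apply (fun z => ∑ i ∈ s, f i z) = ∑ i ∈ s, J.apply (f i) := by
  classical
  induction s using Finset.induction_on with
  | empty => simpa using J.apply_const 0
  | insert a s ha ih =>
    simp only [Finset.sum_insert ha]
    rw [apply_add (hf a (Finset.mem_insert_self a s)) fun k => Finset.analyticAt_fun_sum _
      fun i hi => hf i (Finset.mem_insert_of_mem hi) k,
      ih fun i hi => hf i (Finset.mem_insert_of_mem hi)]

lemma apply_pow {f : ℂ → ℂ} (hf : ∀ k, AnalyticAt ℂ f (J.eigenvalue k)) (l : ℕ) :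
    J.apply (fun z => f z ^ l) = J.apply f ^ l := by
  induction l with
  | zero => simpa using J.apply_const 1
  | succ l ih =>
    simp only [pow_succ]
    have h : ∀ k, AnalyticAt ℂ (fun z => f z ^ l) (J.eigenvalue k) := fun k => (hf k).pow l
    rw [apply_mul h hf, ih]

/-- By multiplicativity, as `w - ζ` and its inverse have product `1` near each eigenvalue. -/
lemma matrixResolvent_eq_apply {w : ℂ} (hw : ∀ k, J.eigenvalue k ≠ w) :
    matrixResolvent A w = J.apply fun ζ => (w - ζ)⁻¹ := by
  refine Matrix.inv_eq_right_inv ?_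
  have h1 : ∀ k, AnalyticAt ℂ (fun ζ => w - ζ) (J.eigenvalue k) := fun k =>
    analyticAt_const.sub analyticAt_id
  have h2 : ∀ k, AnalyticAt ℂ (fun ζ => (w - ζ)⁻¹) (J.eigenvalue k) := fun k =>
    (h1 k).inv (sub_ne_zero.2 (hw k).symm)
  rw [← J.apply_const_sub, ← apply_mul h1 h2, ← one_smul ℂ (1 : Matrix (Fin m) (Fin m) ℂ),
    ← J.apply_const]
  refine apply_congr fun k => ?_
  filter_upwards [isOpen_ne.mem_nhds (hw k)] with ζ hζ
  exact mul_inv_cancel₀ (sub_ne_zero.2 (Ne.symm hζ))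

variable (J)

lemma eigenvalue_mem_spectrum (k : Fin J.p) : J.eigenvalue k ∈ spectrum ℂ A := by
  rw [spectrum.mem_iff]
  intro hu
  set a := J.eigenvalue k with ha
  let e : Fin (J.size k) := ⟨0, J.size_pos k⟩
  -- The first column of `a • 1 - jordanBlock a n` is zero, so `a - A` annihilates this nonzero
  -- matrix and is not a unit.
  let N : ∀ k, Matrix (Fin (J.size k)) (Fin (J.size k)) ℂ := Pi.single k (Matrix.single e e 1)
  have h1 : algebraMap ℂ (Matrix (Fin m) (Fin m) ℂ) a - A =
      J.ofBlocks fun k => jordanBlockFun (fun ζ => a - ζ) (J.eigenvalue k) (J.size k) := by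
    rw [← apply_eq_ofBlocks, J.apply_const_sub, Algebra.algebraMap_eq_smul_one]
  have h2 : (algebraMap ℂ (Matrix (Fin m) (Fin m) ℂ) a - A) * J.ofBlocks N = 0 := by
    rw [h1, ← J.ofBlocks_mul, ← J.ofBlocks_zero]
    congr 1
    funext k'
    by_cases hk : k' = k
    · subst hk
      rw [jordanBlockFun_const_sub]
      simp only [N, Pi.single_eq_same]
      ext i j
      rw [Matrix.zero_apply]
      by_cases hj : j = e
      · subst hj
        rw [Matrix.mul_single_apply_same]
        have : (0 : ℕ) ≠ i + 1 := by omega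
        by_cases hi : i = e
        · simp [jordanBlock, hi, ha]
        · simp [jordanBlock, hi, e]
      · exact Matrix.mul_single_apply_of_ne _ _ _ _ _ hj _
    · simp [N, hk]
  have h3 : J.ofBlocks N = J.ofBlocks fun _ => 0 := by
    rw [J.ofBlocks_zero]; exact hu.mul_right_eq_zero.1 h2
  have h4 := congrFun (congrFun (congrFun (J.ofBlocks_injective h3) k) e) e
  simp [N] at h4

end JordanForm

/-! ### Matrix-valued contour integrals -/

section contour

variable {x : ℂ} {γ : Path x x} {m : ℕ}

lemma matrixContourIntegral_mul_mul (hγ : AbsolutelyContinuousOnInterval γ.extend 0 1)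
    (P Q : Matrix (Fin m) (Fin m) ℂ) {G : ℂ → Matrix (Fin m) (Fin m) ℂ}
    (hG : ∀ i j, ContinuousOn (fun w => G w i j) (range γ)) :
    matrixContourIntegral γ (fun w => P * G w * Q) = P * matrixContourIntegral γ G * Q := by
  ext i j
  have hc : ∀ a b, ContinuousOn (fun w => P i a * G w a b * Q b j) (range γ) := fun a b =>
    (continuousOn_const.mul (hG a b)).mul continuousOn_const
  simp only [matrixContourIntegral, Matrix.of_apply, Matrix.mul_apply, Finset.sum_mul]
  rw [contourIntegral_finset_sum hγ _ fun b _ => continuousOn_finsetSum _ fun a _ => hc a b]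
  refine Finset.sum_congr rfl fun b _ => ?_
  rw [contourIntegral_finset_sum hγ _ fun a _ => hc a b]
  refine Finset.sum_congr rfl fun a _ => ?_
  have : (fun w => P i a * G w a b * Q b j) = fun w => (P i a * Q b j) * G w a b := by
    funext w; ring
  rw [this, contourIntegral_const_mul]
  ring

lemma matrixContourIntegral_congr {G H : ℂ → Matrix (Fin m) (Fin m) ℂ}
    (h : EqOn G H (range γ)) : matrixContourIntegral γ G = matrixContourIntegral γ H := by
  ext i j
  exact contourIntegral_congr fun w hw => by rw [h hw]

end contour

/-! ### Existence of the Jordan form -/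

section jordan

open Polynomial

lemma exists_basis_quotient_X_sub_C_pow (lam : ℂ) (n : ℕ) {I : Submodule ℂ[X] ℂ[X]}
    (hI : I = Ideal.span {(X - C lam) ^ n}) :
    ∃ b : Module.Basis (Fin n) ℂ (ℂ[X] ⧸ I), ∀ j,
      (X : ℂ[X]) • b j = ∑ i, jordanBlock lam n i j • b i := by
  subst hI
  set I := Ideal.span {(X - C lam : ℂ[X]) ^ n} with hI
  let u : ℕ → ℂ[X] ⧸ I := fun i => Ideal.Quotient.mk I ((X - C lam) ^ i)
  have hu0 : ∀ i, n ≤ i → u i = 0 := fun i hi =>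
    Ideal.Quotient.eq_zero_iff_mem.2 (Ideal.mem_span_singleton.2 (pow_dvd_pow _ hi))
  -- Taylor expansion at `lam` shows spanning; a dimension count then gives a basis. The decreasing
  -- exponents put the ones above the diagonal.
  have hspan : ⊤ ≤ Submodule.span ℂ (Set.range fun j : Fin n => u (n - 1 - j)) := by
    rintro q -
    obtain ⟨f, rfl⟩ := Ideal.Quotient.mk_surjective q
    rw [← sum_taylor_eq f lam, Polynomial.sum, map_sum]
    refine Submodule.sum_mem _ fun i _ => ?_
    have h1 : Ideal.Quotient.mk I (C ((taylor lam f).coeff i) * (X - C lam) ^ i) =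
        (taylor lam f).coeff i • u i := by
      rw [← smul_eq_C_mul]; rfl
    rw [h1]
    refine Submodule.smul_mem _ _ ?_
    by_cases hi : i < n
    · refine Submodule.subset_span ⟨⟨n - 1 - i, by omega⟩, ?_⟩
      simp only
      congr 1
      omega
    · rw [hu0 i (not_lt.1 hi)]
      exact Submodule.zero_mem _
  have hcard : Fintype.card (Fin n) = Module.finrank ℂ (ℂ[X] ⧸ I) := by
    rw [hI, finrank_quotient_span_eq_natDegree, natDegree_pow, natDegree_X_sub_C, mul_one,
      Fintype.card_fin]
  refine ⟨basisOfTopLeSpanOfCardEqFinrank _ hspan hcard, fun j => ?_⟩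
  simp only [coe_basisOfTopLeSpanOfCardEqFinrank]
  have hX : (X : ℂ[X]) • u (n - 1 - j) = lam • u (n - 1 - j) + u (n - 1 - j + 1) := by
    have h : (X : ℂ[X]) * (X - C lam) ^ (n - 1 - (j : ℕ)) =
        lam • (X - C lam) ^ (n - 1 - (j : ℕ)) + (X - C lam) ^ (n - 1 - (j : ℕ) + 1) := by
      rw [smul_eq_C_mul, pow_succ]; ring
    exact congrArg (Ideal.Quotient.mk I) h
  rw [hX]
  have hsplit : ∀ i : Fin n, jordanBlock lam n i j • u (n - 1 - i) =
      (if i = j then lam • u (n - 1 - i) else 0) +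
        if (j : ℕ) = i + 1 then u (n - 1 - i) else 0 := by
    intro i
    by_cases h1 : i = j
    · simp [jordanBlock, h1]
    · by_cases h2 : (j : ℕ) = i + 1 <;> simp [jordanBlock, h1, h2]
  rw [Finset.sum_congr rfl fun i _ => hsplit i, Finset.sum_add_distrib,
    Finset.sum_ite_eq' Finset.univ j, if_pos (Finset.mem_univ j)]
  congr 1
  -- For `j = 0` the shifted vector is `u n = 0`; otherwise it is the basis vector of index `j - 1`.
  by_cases hj : (j : ℕ) = 0
  · rw [hu0 _ (by omega), Finset.sum_eq_zero]
    intro i _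
    rw [if_neg (by omega)]
  · rw [Finset.sum_eq_single (⟨j - 1, by omega⟩ : Fin n)]
    · rw [if_pos (by simp only; omega)]
      congr 1
      simp only
      omega
    · intro i _ hi
      rw [if_neg fun h => hi (Fin.ext (by simp only; omega))]
    · exact fun h => absurd (Finset.mem_univ _) h

lemma exists_span_eq_X_sub_C_pow {p : ℂ[X]} (hp : Irreducible p) :
    ∃ lam : ℂ, ∀ e : ℕ, Submodule.span ℂ[X] {p ^ e} = Ideal.span {(X - C lam) ^ e} := by
  obtain ⟨lam, hlam⟩ := IsAlgClosed.exists_root p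
    (by rw [IsAlgClosed.degree_eq_one_of_irreducible ℂ hp]; exact one_ne_zero)
  refine ⟨lam, fun e => ?_⟩
  have h := ((irreducible_X_sub_C lam).associated_of_dvd hp (dvd_iff_isRoot.2 hlam)).symm
  exact Ideal.span_singleton_eq_span_singleton.2 (h.pow_pow (n := e))

/-- A vector space with an endomorphism has a basis that puts the endomorphism in Jordan form. -/
theorem exists_jordan_basis {M : Type} [AddCommGroup M] [Module ℂ M] [FiniteDimensional ℂ M]
    (T : M →ₗ[ℂ] M) :
    ∃ (ι : Type) (_ : Fintype ι) (e : ι → ℕ) (lam : ι → ℂ)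
      (b : Module.Basis (Σ i, Fin (e i)) ℂ M), ∀ i j,
        T (b ⟨i, j⟩) = ∑ a, jordanBlock (lam i) (e i) a j • b ⟨i, a⟩ := by
  classical
  -- With `X` acting as `T`, finite dimensionality makes `M` a torsion `ℂ[X]`-module, hence a sum of
  -- quotients by powers of irreducibles, each associated to some `X - C lam`.
  obtain ⟨ι, hι, p, hp, e, ⟨φ⟩⟩ := Module.equiv_directSum_of_isTorsion
    (R := ℂ[X]) (M := Module.AEval' T) (Module.AEval.isTorsion_of_finiteDimensional ℂ M T)
  choose lam hlam using fun i => exists_span_eq_X_sub_C_pow (hp i)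
  choose b hb using fun i => exists_basis_quotient_X_sub_C_pow (lam i) (e i) (hlam i (e i))
  let Q : ι → Type := fun i => ℂ[X] ⧸ Submodule.span ℂ[X] {p i ^ e i}
  let B : Module.Basis (Σ i, Fin (e i)) ℂ (∀ i, Q i) := Pi.basis b
  let φ' : Module.AEval' T ≃ₗ[ℂ[X]] (∀ i, Q i) :=
    φ.trans (DirectSum.linearEquivFunOnFintype ℂ[X] ι Q)
  let ψ : (∀ i, Q i) ≃ₗ[ℂ] M := (φ'.restrictScalars ℂ).symm.trans (Module.AEval'.of T).symm
  refine ⟨ι, hι, e, lam, B.map ψ, fun i j => ?_⟩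
  have hB : ∀ a, B ⟨i, a⟩ = LinearMap.single ℂ Q i (b i a) := fun a => Pi.basis_apply ..
  have hT : ∀ y, T (ψ y) = ψ ((X : ℂ[X]) • y) := by
    intro y
    apply (Module.AEval'.of T).injective
    have h1 : φ'.symm ((X : ℂ[X]) • y) = (X : ℂ[X]) • φ'.symm y := map_smul _ _ _
    have h2 : (Module.AEval'.of T) (ψ ((X : ℂ[X]) • y)) = φ'.symm ((X : ℂ[X]) • y) :=
      (Module.AEval'.of T).apply_symm_apply _
    have h3 : (Module.AEval'.of T) (ψ y) = φ'.symm y := (Module.AEval'.of T).apply_symm_apply _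
    rw [← Module.AEval'.X_smul_of, h2, h3, h1]
  have hX : (X : ℂ[X]) • LinearMap.single ℂ Q i (b i j) =
      LinearMap.single ℂ Q i ((X : ℂ[X]) • b i j) :=
    ((LinearMap.single ℂ[X] Q i).map_smul (X : ℂ[X]) (b i j)).symm
  rw [Module.Basis.map_apply, hT, hB, hX, hb, map_sum, map_sum]
  refine Finset.sum_congr rfl fun a _ => ?_
  rw [Module.Basis.map_apply, hB, map_smul, map_smul]

/-- The Jordan form read off from a Jordan basis. -/
theorem nonempty_jordanForm_of_basis {m : ℕ} (A : Matrix (Fin m) (Fin m) ℂ) {ι : Type} [Fintype ι]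
    {e : ι → ℕ} {lam : ι → ℂ} (b : Module.Basis (Σ i, Fin (e i)) ℂ (Fin m → ℂ))
    (hb : ∀ i j, A.mulVec (b ⟨i, j⟩) = ∑ a, jordanBlock (lam i) (e i) a j • b ⟨i, a⟩) :
    Nonempty (JordanForm A) := by
  classical
  -- Exponents `e i = 0` are allowed in `e`; their blocks are empty, so discarding them loses no
  -- basis vector and secures `size_pos`.
  let σ := Fintype.equivFin {i // 0 < e i}
  let τ : (Σ k : Fin (Fintype.card {i // 0 < e i}), Fin (e (σ.symm k).1)) → Σ i, Fin (e i) :=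
    Sigma.map (fun k => (σ.symm k).1) fun _ => id
  have hτ : Function.Bijective τ := by
    refine ⟨(Subtype.val_injective.comp σ.symm.injective).sigma_map
      fun _ => Function.injective_id, ?_⟩
    rintro ⟨i, a⟩
    obtain ⟨k, hk⟩ := σ.symm.surjective ⟨i, a.pos⟩
    have hk' : i = (σ.symm k).1 := by rw [hk]
    subst hk'
    exact ⟨⟨k, a⟩, rfl⟩
  let b' := b.reindex (Equiv.ofBijective τ hτ).symm
  have hb'a : ∀ s, b' s = b (τ s) := fun s => by simp [b']
  have hcard : Fintype.card (Σ k : Fin (Fintype.card {i // 0 < e i}), Fin (e (σ.symm k).1)) =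
      m := by
    rw [← Module.finrank_eq_card_basis b', Module.finrank_fin_fun]
  let index := Fintype.equivFinOfCardEq hcard
  let V : Matrix (Fin m) (Fin m) ℂ := Matrix.of fun i j => b' (index.symm j) i
  have hV : IsUnit V := by
    rw [← Matrix.linearIndependent_cols_iff_isUnit]
    have h : V.col = b'.reindex index := by
      ext j i
      simp [V, Matrix.col]
    rw [h]
    exact (b'.reindex index).linearIndependent
  refine ⟨⟨_, fun k => e (σ.symm k).1, fun k => (σ.symm k).2, fun k => lam (σ.symm k).1, index, V,
    hV, ?_⟩⟩
  have hVdet := (Matrix.isUnit_iff_isUnit_det _).1 hV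
  suffices h : A * V = V * Matrix.reindex index index (Matrix.blockDiagonal' fun k =>
      jordanBlock (lam (σ.symm k).1) (e (σ.symm k).1)) by
    rw [Matrix.mul_assoc, h, ← Matrix.mul_assoc, Matrix.nonsing_inv_mul _ hVdet, Matrix.one_mul]
  have hVb : ∀ i s, V i (index s) = b' s i := fun i s => by simp [V]
  ext i j
  obtain ⟨⟨k, a⟩, rfl⟩ := index.surjective j
  have h1 : (A * V) i (index ⟨k, a⟩) = A.mulVec (b' ⟨k, a⟩) i := by
    simp [Matrix.mul_apply, Matrix.mulVec, dotProduct, V]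
  have h2 := hb (σ.symm k).1 a
  rw [h1, hb'a]
  refine (congrFun h2 i).trans ?_
  rw [Matrix.mul_apply, ← Equiv.sum_comp index, Fintype.sum_sigma, Finset.sum_eq_single k]
  · simp only [hVb, hb'a]
    simp [τ, Sigma.map, Matrix.blockDiagonal'_apply, mul_comm]
  · intro k' _ hk
    simp [Matrix.blockDiagonal'_apply, hk]
  · exact fun h => absurd (Finset.mem_univ _) h

theorem nonempty_jordanForm {m : ℕ} (A : Matrix (Fin m) (Fin m) ℂ) : Nonempty (JordanForm A) := by
  obtain ⟨ι, _, e, lam, b, hb⟩ := exists_jordan_basis (Matrix.toLin' A)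
  exact nonempty_jordanForm_of_basis A b fun i j => by simpa using hb i j

end jordan

/-! ### Evaluation at the matrix and the main theorem -/

/-- The signs of the correction term come from `(ζ - w)⁻¹ ^ l = (-1) ^ l * (w - ζ)⁻¹ ^ l`, where `(w
- ζ)⁻¹` evaluates to the resolvent at `w`. -/
lemma JordanForm.apply_principalPart {m : ℕ} {A : Matrix (Fin m) (Fin m) ℂ} (J : JordanForm A)
    (f : ℂ → ℂ) {w : ℂ} (d : ℕ) (hw : ∀ k, J.eigenvalue k ≠ w) :
    J.apply (principalPart f w d) =
      -correctionTerm f w d (w • (1 : Matrix (Fin m) (Fin m) ℂ) - A) := by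
  have han : ∀ k, AnalyticAt ℂ (fun ζ => (w - ζ)⁻¹) (J.eigenvalue k) := fun k =>
    (analyticAt_const.sub analyticAt_id).inv (sub_ne_zero.2 (hw k).symm)
  have hpow : ∀ (c : ℂ) (l : ℕ) (k),
      AnalyticAt ℂ (fun ζ => c * ((w - ζ)⁻¹) ^ l) (J.eigenvalue k) := fun c l k =>
    analyticAt_const.mul ((han k).pow l)
  have h : principalPart f w d = fun ζ => ∑ l ∈ Finset.Icc 1 d,
      ((-1) ^ l * (iteratedDeriv (d - l) (poleRemoved f w d) w / ((d - l).factorial : ℂ))) *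
        ((w - ζ)⁻¹) ^ l := by
    funext ζ
    refine Finset.sum_congr rfl fun l _ => ?_
    rw [← neg_sub w ζ, inv_neg, neg_pow]
    ring
  rw [h, JordanForm.apply_finset_sum _ fun l _ k => hpow _ l k,
    correctionTerm, ← Finset.sum_neg_distrib]
  refine Finset.sum_congr rfl fun l _ => ?_
  rw [J.apply_const_mul, JordanForm.apply_pow han, ← JordanForm.matrixResolvent_eq_apply hw,
    ← neg_smul, pow_succ, matrixResolvent]
  congr 1
  ring

lemma JordanForm.apply_regularPart {m t : ℕ} {A : Matrix (Fin m) (Fin m) ℂ} (J : JordanForm A)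
    {f : ℂ → ℂ} {z : Fin t → ℂ} (d : Fin t → ℕ) (hf : ∀ k, AnalyticAt ℂ f (J.eigenvalue k))
    (hz : ∀ k j, J.eigenvalue k ≠ z j) :
    J.apply (regularPart f z d) = J.apply f +
      ∑ j, correctionTerm f (z j) (d j) (z j • (1 : Matrix (Fin m) (Fin m) ℂ) - A) := by
  have hp : ∀ j ∈ Finset.univ, ∀ k, AnalyticAt ℂ (principalPart f (z j) (d j)) (J.eigenvalue k) :=
    fun j _ k => analyticAt_principalPart f (d j) (hz k j)
  have hs : ∀ k, AnalyticAt ℂ (fun ζ => (-1) * ∑ j, principalPart f (z j) (d j) ζ)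
      (J.eigenvalue k) := fun k =>
    analyticAt_const.mul (Finset.analyticAt_fun_sum _ fun j hj => hp j hj k)
  have h : regularPart f z d = fun ζ => f ζ + (-1) * ∑ j, principalPart f (z j) (d j) ζ := by
    funext ζ; rw [regularPart]; ring
  rw [h, JordanForm.apply_add hf hs, J.apply_const_mul,
    JordanForm.apply_finset_sum _ hp, neg_one_smul, ← Finset.sum_neg_distrib]
  congr 1
  refine Finset.sum_congr rfl fun j _ => ?_
  rw [J.apply_principalPart f (d j) fun k => hz k j, neg_neg]

/-- Conjugation by `V` commutes with integration, and entry `(i, j)` of a block, `i ≤ j`, integrates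
to `2πi` times the Taylor coefficient of order `j - i` of the regular part. -/
lemma matrixContourIntegral_resolvent {m t : ℕ} {A : Matrix (Fin m) (Fin m) ℂ}
    (J : JordanForm A) {D : Set ℂ} {f : ℂ → ℂ} (hf : IsMeromorphicFunctionOn f D) {x : ℂ}
    {γ : Path x x} (hγ : IsPositiveJordanContour γ)
    (hγD : range γ ⊆ D) (hγD' : enclosedRegion γ ⊆ D) (hγf : Disjoint (range γ) (polesIn f D))
    {z : Fin t → ℂ} (hz : Function.Injective z) (hzγ : range z = polesIn f D ∩ enclosedRegion γ)
    {d : Fin t → ℕ}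
    (hd : ∀ j, meromorphicOrderAt f (z j) = ((-(d j : ℤ) : ℤ) : WithTop ℤ))
    (hJγ : ∀ k, J.eigenvalue k ∈ enclosedRegion γ) (hJf : ∀ k, J.eigenvalue k ∉ polesIn f D) :
    matrixContourIntegral γ (fun w => f w • matrixResolvent A w) =
      (2 * Real.pi * Complex.I : ℂ) • J.apply (regularPart f z d) := by
  have hfc : ContinuousOn f (range γ) := fun w hw => (hf.holomorphic w ⟨hγD hw, fun h =>
    disjoint_left.1 hγf hw h⟩).continuousAt.continuousWithinAt
  have hres : EqOn (fun w => f w • matrixResolvent A w) (fun w => J.V *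
      Matrix.reindex J.index J.index (Matrix.blockDiagonal' fun k =>
        f w • jordanBlockFun (fun ζ => (w - ζ)⁻¹) (J.eigenvalue k) (J.size k)) * J.V⁻¹)
      (range γ) := fun w hw => by
    simp only
    rw [JordanForm.matrixResolvent_eq_apply fun k h => (hJγ k).1 (h ▸ hw), J.apply_eq_ofBlocks,
      ← J.ofBlocks_smul, JordanForm.ofBlocks]
  have hentry : ∀ k i j w, w ∈ range γ →
      (f w • jordanBlockFun (fun ζ => (w - ζ)⁻¹) (J.eigenvalue k) (J.size k)) i j =
        if i ≤ j then f w * ((w - J.eigenvalue k)⁻¹) ^ ((j : ℕ) - i + 1) else 0 := by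
    intro k i j w hw
    have hne : J.eigenvalue k ≠ w := fun h => (hJγ k).1 (h ▸ hw)
    simp only [jordanBlockFun, Matrix.smul_apply, Matrix.of_apply, smul_eq_mul, mul_ite, mul_zero,
      iteratedDeriv_inv_const_sub hne]
  have hcont : ∀ k (i j : Fin (J.size k)), ContinuousOn (fun w =>
      (f w • jordanBlockFun (fun ζ => (w - ζ)⁻¹) (J.eigenvalue k) (J.size k)) i j) (range γ) := by
    intro k i j
    refine ContinuousOn.congr ?_ (hentry k i j)
    split_ifs
    · exact hfc.mul ((continuousOn_inv_sub (hJγ k).1).pow _)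
    · exact continuousOn_const
  rw [matrixContourIntegral_congr hres, matrixContourIntegral_mul_mul hγ.absCont,
    J.apply_eq_ofBlocks, ← J.ofBlocks_smul, JordanForm.ofBlocks]
  · congr 2
    ext i j
    obtain ⟨⟨k, a⟩, rfl⟩ := J.index.surjective i
    obtain ⟨⟨k', b⟩, rfl⟩ := J.index.surjective j
    simp only [matrixContourIntegral, Matrix.of_apply, Matrix.reindex_apply,
      Matrix.submatrix_apply, Equiv.symm_apply_apply]
    by_cases hk : k = k'
    · subst hk
      simp only [Matrix.blockDiagonal'_apply_eq]
      rw [contourIntegral_congr (hentry k a b)]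
      simp only [jordanBlockFun, Matrix.smul_apply, Matrix.of_apply, smul_eq_mul]
      split_ifs
      · exact contourIntegral_meromorphic_mul_inv_pow hf hγ hγD hγD' hγf hz hzγ hd (hJγ k)
          (hJf k) _
      · rw [contourIntegral_zero, mul_zero]
    · simp only [Matrix.blockDiagonal'_apply_ne _ _ _ hk]
      exact contourIntegral_zero
  · intro i j
    obtain ⟨⟨k, a⟩, rfl⟩ := J.index.surjective i
    obtain ⟨⟨k', b⟩, rfl⟩ := J.index.surjective j
    simp only [Matrix.reindex_apply, Matrix.submatrix_apply, Equiv.symm_apply_apply]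
    by_cases hk : k = k'
    · subst hk
      simp only [Matrix.blockDiagonal'_apply_eq]
      exact hcont k a b
    · simp only [Matrix.blockDiagonal'_apply_ne _ _ _ hk]
      exact continuousOn_const

theorem mainTheorem2 {m t : ℕ} (A : Matrix (Fin m) (Fin m) ℂ)
    (D : Set ℂ) (hD : IsOpen D) (f : ℂ → ℂ) (hf : IsMeromorphicFunctionOn f D)
    (hAf : Disjoint (spectrum ℂ A) (polesIn f D))
    {x : ℂ} (γ : Path x x) (hγ : IsPositiveJordanContour γ)
    (hγD : range γ ⊆ D) (hγD' : enclosedRegion γ ⊆ D)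
    (hγf : Disjoint (range γ) (polesIn f D))
    (hAγ : spectrum ℂ A ⊆ enclosedRegion γ)
    (z : Fin t → ℂ) (hz : Function.Injective z)
    (hzγ : range z = polesIn f D ∩ enclosedRegion γ)
    (d : Fin t → ℕ) (hd : ∀ j, meromorphicOrderAt f (z j) = ((-(d j : ℤ) : ℤ) : WithTop ℤ)) :
    (2 * Real.pi * Complex.I : ℂ)⁻¹ •
          matrixContourIntegral γ (fun w => f w • matrixResolvent A w) =
        matrixFunction f A +
          ∑ j, correctionTerm f (z j) (d j) (z j • (1 : Matrix (Fin m) (Fin m) ℂ) - A) ∧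
      ((∀ j, d j = 1) →
        (2 * Real.pi * Complex.I : ℂ)⁻¹ •
            matrixContourIntegral γ (fun w => f w • matrixResolvent A w) =
          matrixFunction f A +
            ∑ j, poleRemoved f (z j) (d j) (z j) • matrixResolvent A (z j)) := by
  have hJ := nonempty_jordanForm A
  -- The argument below works for any Jordan form, so the arbitrary choice is harmless.
  have hfA : matrixFunction f A = hJ.some.apply f := dif_pos hJ
  set J := hJ.some
  have hspec := J.eigenvalue_mem_spectrum
  have hJf : ∀ k, J.eigenvalue k ∉ polesIn f D := fun k => disjoint_left.1 hAf (hspec k)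
  have hmain : (2 * Real.pi * Complex.I : ℂ)⁻¹ •
      matrixContourIntegral γ (fun w => f w • matrixResolvent A w) = matrixFunction f A +
        ∑ j, correctionTerm f (z j) (d j) (z j • (1 : Matrix (Fin m) (Fin m) ℂ) - A) := by
    rw [matrixContourIntegral_resolvent J hf hγ hγD hγD' hγf hz hzγ hd (fun k => hAγ (hspec k)) hJf,
      inv_smul_smul₀ Complex.two_pi_I_ne_zero, hfA]
    refine J.apply_regularPart d (fun k => hf.holomorphic _ ⟨hγD' (hAγ (hspec k)), hJf k⟩)
      fun k j h => hJf k ?_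
    rw [h]
    exact (hzγ ▸ mem_range_self j : z j ∈ polesIn f D ∩ enclosedRegion γ).1
  refine ⟨hmain, fun h1 => ?_⟩
  rw [hmain]
  congr 1
  refine Finset.sum_congr rfl fun j _ => ?_
  -- For a simple pole only `l = 1` occurs, with sign `+1` and a derivative of order `0`.
  simp [correctionTerm, matrixResolvent, h1 j]
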